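/- **Setting.** Let $A$ be a local principal ideal ring (commutative) with maximal ideal $\wp=(\pi)$ and residue field $\mathbf k$. Let $k\in\{1,2,\dots,\infty\}$ be its length, i.e. the least $k$ with $\wp^k=0$ ($k=\infty$ if there is none). Let $v$ be the valuation on $A$ with the convention $v(0)=k$, and let $v(\wp)=\{v(x)\mid x\in\wp\}$. For $m\in\{1,2,\dots,\infty\}$ let $A_m=A/\wp^m$, with $A_\infty=A$ (used only if $k=\infty$); its valuation is normalised in the same way by $v(0)=m$. Let $A_m^{\times,\delta}=\{a\in A_m^\times\mid v(a-1)=\delta\}$. $B$ denotes the group of invertible upper triangular matrices (of size $3$ or $2$), and $M_2^\bullet$ the set of $2\times2$ matrices over $A$ of which only the top right entry is a unit; $B\backslash M_2^\bullet/B$ is the set of orbits under left and right multiplication by $B\subset GL_2(A)$. Let $s_1=(1\,2)$, $s_2=(2\,3)\in S_3$, and identify $w\in S_3$ with the matrix of $e_j\mapsto e_{w(j)}$. **Corollary (parametrization).** (0) $w\mapsto BwB$ is a bijection $S_3\to B\backslash GL_3(\mathbf k)/B$. Hence reduction modulo $\wp$ maps $B\backslash GL_3(A)/B$ to $S_3$.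 (1) There is a bijection $$B\backslash GL_3(A)/B\;\cong\;(B\backslash M_2^\bullet/B)\sqcup (v(\wp)\times v(\wp))\sqcup(v(\wp)\times v(\wp))\sqcup v(\wp)\sqcup v(\wp)\sqcup\{\star\},$$ under which the six pieces are the fibres over $1,\ s_1,\ s_2,\ s_1s_2,\ s_2s_1,\ s_1s_2s_1$ respectively. It is given explicitly as follows. If the lower left $2\times2$ submatrix $\alpha$ of $g\in GL_3(A)$ is in $M_2^\bullet$, then $BgB$ corresponds to the orbit $B\alpha B$. For $x,y\in\wp$ the double cosets of $$\begin{pmatrix}0&1&0\\1&0&0\\x&y&1\end{pmatrix},\ \begin{pmatrix}1&0&0\\x&0&1\\y&1&0\end{pmatrix},\ \begin{pmatrix}0&0&1\\1&0&0\\x&1&0\end{pmatrix},\ \begin{pmatrix}0&1&0\\0&x&1\\1&0&0\end{pmatrix},\ \begin{pmatrix}0&0&1\\0&1&0\\1&0&0\end{pmatrix}$$ correspond to $(v(x),v(y))$, $(v(x),v(y))$, $v(x)$, $v(x)$ and $\star$ in the second to the sixth piece. (2) With $\epsilon=\min\{j-i,\,j-l,\,i,\,l\}$ there is a bijection $$B\backslash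 M_2^\bullet/B\;\cong\;\coprod_{2\le j<k}\Biggl[\Bigl(\coprod_{\substack{1\le i,l\le j-1\\ i+l\ne j}}A^\times_{\min\{\epsilon,k-j\}}\Bigr)\sqcup\Bigl(\coprod_{\substack{1\le i,l\le j-1\\ i+l=j}}\ \coprod_{0\le\delta\le k-j}A^{\times,\delta}_{\min\{\epsilon+\delta,k-j\}}\Bigr)\Biggr]\sqcup D,$$ where $i,j,l$ are integers in the first two families, $\delta=\infty$ is allowed if $k=\infty$, and $D$ is the set of the matrices $\begin{pmatrix}i&0\\j&l\end{pmatrix}$ with entries in $\{0,1,2,\dots,\infty\}$ satisfying one of: $j=k$ and $1\le i,l\le k$; $1\le i<j<k=l$; $1\le l<j<k=i$; $1\le j<k=i=l$. It is given explicitly as follows. For a unit $a\in A^\times$ the orbit of $\begin{pmatrix}\pi^i&1\\ \pi^ja&\pi^l\end{pmatrix}$ corresponds to the residue class of $a$ in the piece indexed by $(i,j,l)$ (if $i+l\neq j$), respectively in the piece indexed by $(i,j,l,\delta)$ whenever that class lies in $A^{\times,\delta}_{\min\{\epsilon+\delta,k-j\}}$ (if $i+l=j$). The orbit of a matrix $\alpha\in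 M_2^\bullet$ whose matrix of valuations $(v(\alpha_{rs}))$ lies in $D$ corresponds to that matrix. -/

import Mathlib

open IsLocalRing

namespace LocalBruhat

universe u

section Borel

variable (n : ℕ) (R : Type u) [CommRing R]

/-- The subgroup `B` of upper triangular matrices in `GL n R`. -/
def borel : Subgroup (GL (Fin n) R) where
  carrier := {g | ∀ i j : Fin n, j < i → g.1 i j = 0}
  one_mem' := fun i j h => by simp [Matrix.one_apply_ne h.ne']
  mul_mem' := by
    intro a b ha hb i j h
    exact Matrix.BlockTriangular.mul (b := id) (M := a.1) (N := b.1) ha hb h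
  inv_mem' := by
    intro a ha i j h
    have : Invertible a.1 := a.invertible
    rw [Matrix.coe_units_inv]
    exact Matrix.blockTriangular_inv_of_blockTriangular (b := id) (M := a.1) ha h

/-- The double coset space `B \ GL_3(R) / B`. -/
abbrev BGB : Type u :=
  DoubleCoset.Quotient (borel 3 R : Set (GL (Fin 3) R)) (borel 3 R)

/-- The double coset `B g B` of `g`. -/
abbrev cosetOf {R : Type u} [CommRing R] (g : GL (Fin 3) R) : BGB R :=
  DoubleCoset.mk (borel 3 R) (borel 3 R) g

/-- The permutation matrix of `w` as an element of `GL_3(R)`; it maps the `j`-th standard basis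
vector to the `w j`-th one. -/
def permGL (w : Equiv.Perm (Fin 3)) : GL (Fin 3) R where
  val := Matrix.of fun i j => if i = w j then 1 else 0
  inv := Matrix.of fun i j => if w i = j then 1 else 0
  val_inv := by
    ext i j
    simp only [Matrix.mul_apply, Matrix.of_apply, Matrix.one_apply]
    rw [Finset.sum_eq_single (w.symm i)]
    · simp
    · intro b _ hb
      have : i ≠ w b := fun h => hb (by simp [h])
      simp [this]
    · simp
  inv_val := by
    ext i j
    simp [Matrix.mul_apply, Matrix.one_apply]

end Borel

section Reduction

variable (A : Type u) [CommRing A] [IsLocalRing A]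

/-- Reduction modulo the maximal ideal, `B \ GL_3(A) / B → B \ GL_3(𝐤) / B`. -/
def reduce : BGB A → BGB (ResidueField A) :=
  Quotient.map (Matrix.GeneralLinearGroup.map (residue A)) (by
    intro g g' h
    obtain ⟨b, hb, c, hc, rfl⟩ := DoubleCoset.rel_iff.1 h
    refine DoubleCoset.rel_iff.2
      ⟨Matrix.GeneralLinearGroup.map (residue A) b, ?_,
        Matrix.GeneralLinearGroup.map (residue A) c, ?_, by simp⟩
    · intro i j hij
      simp [hb i j hij]
    · intro i j hij
      simp [hc i j hij])

end Reduction

section Valuation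

variable {R : Type u} [CommRing R]

/-- The least `n` such that `I ^ n = 0`, or `∞` if there is none. -/
noncomputable def nilLength (I : Ideal R) : ℕ∞ :=
  ⨅ (n : ℕ) (_ : I ^ n = ⊥), (n : ℕ∞)

open Classical in
/-- The `I`-adic valuation: the largest `n` with `x ∈ I ^ n` for `x ≠ 0`, and the length
`nilLength I` for `x = 0`. -/
noncomputable def val (I : Ideal R) (x : R) : ℕ∞ :=
  if x = 0 then nilLength I else ⨆ (n : ℕ) (_ : x ∈ I ^ n), (n : ℕ∞)

end Valuation

section Local

variable (A : Type u) [CommRing A] [IsLocalRing A]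

/-- The length `k` of the local ring `A`. -/
noncomputable def len : ℕ∞ := nilLength (maximalIdeal A)

variable {A} in
/-- The valuation `v` of `A`, with `v 0 = k`. -/
noncomputable def v (x : A) : ℕ∞ := val (maximalIdeal A) x

/-- The set `v(℘)` of the valuations of the elements of the maximal ideal. -/
def vp : Set ℕ∞ := v '' (maximalIdeal A : Set A)

variable {A} in
/-- The valuation of an element of the maximal ideal, as an element of `v(℘)`. -/
noncomputable def toVp (x : maximalIdeal A) : vp A := ⟨v x.1, x.1, x.2, rfl⟩

/-- The ideal `℘ ^ m`; for `m = ∞` it is the zero ideal. -/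
noncomputable def powIdeal (m : ℕ∞) : Ideal A :=
  if m = ⊤ then ⊥ else maximalIdeal A ^ m.toNat

/-- The ring `A_m = A / ℘ ^ m`; for `m = ∞` nothing is divided out. -/
abbrev Trunc (m : ℕ∞) : Type u := A ⧸ powIdeal A m

variable {A} in
/-- The image in `A_m` of a unit of `A`. -/
noncomputable def unitMod (m : ℕ∞) (a : Aˣ) : (Trunc A m)ˣ :=
  Units.map (Ideal.Quotient.mk (powIdeal A m)).toMonoidHom a

/-- The set `A_m^{×,δ}` of the units `a` of `A_m` with `v (a - 1) = δ`, where `v` is the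
valuation of `A_m`. -/
def unitsDelta (m δ : ℕ∞) : Set (Trunc A m)ˣ :=
  {a | val ((maximalIdeal A).map (Ideal.Quotient.mk (powIdeal A m))) ((a : Trunc A m) - 1) = δ}

/-- The set of the `2 × 2` matrices of which only the top right entry is a unit. -/
def M2 : Set (Matrix (Fin 2) (Fin 2) A) :=
  {α | IsUnit (α 0 1) ∧ ¬ IsUnit (α 0 0) ∧ ¬ IsUnit (α 1 0) ∧ ¬ IsUnit (α 1 1)}

/-- Equivalence of matrices under invertible upper triangular row and column operations. -/
def m2Setoid : Setoid (M2 A) where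
  r α α' := ∃ b ∈ borel 2 A, ∃ c ∈ borel 2 A, α'.1 = b.1 * α.1 * c.1
  iseqv :=
    { refl := fun α => ⟨1, one_mem _, 1, one_mem _, by simp⟩
      symm := by
        rintro α α' ⟨b, hb, c, hc, h⟩
        refine ⟨b⁻¹, inv_mem hb, c⁻¹, inv_mem hc, ?_⟩
        rw [h, ← mul_assoc, ← mul_assoc, Units.inv_mul, one_mul, mul_assoc, Units.mul_inv,
          mul_one]
      trans := by
        rintro α α' α'' ⟨b, hb, c, hc, h⟩ ⟨b', hb', c', hc', h'⟩
        refine ⟨b' * b, mul_mem hb' hb, c * c', mul_mem hc hc', ?_⟩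
        rw [h', h]
        simp only [Units.val_mul, mul_assoc] }

/-- The space of orbits of `B × B` on `M2 A`. -/
abbrev M2Orbits : Type u := Quotient (m2Setoid A)

variable {A} in
/-- The orbit of a matrix. -/
abbrev orbitOf (α : M2 A) : M2Orbits A := Quotient.mk (m2Setoid A) α

/-- `ε = min {j - i, j - l, i, l}` (used for `i, l < j` only). -/
def eps (i j l : ℕ) : ℕ := min (min (j - i) (j - l)) (min i l)

/-- The discrete set of valuation matrices. -/
def discreteSet (k : ℕ∞) : Set (Matrix (Fin 2) (Fin 2) ℕ∞) :=
  {t | ∃ i j l : ℕ∞, t = !![i, 0; j, l] ∧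
    ((j = k ∧ 1 ≤ i ∧ i ≤ k ∧ 1 ≤ l ∧ l ≤ k) ∨
      (1 ≤ i ∧ i < j ∧ j < k ∧ l = k) ∨
      (1 ≤ l ∧ l < j ∧ j < k ∧ i = k) ∨
      (1 ≤ j ∧ j < k ∧ i = k ∧ l = k))}

/-- The disjoint union which parametrises the orbits on `M2 A`. -/
inductive M2Param : Type u
  /-- a point of `A_{min (ε, k - j)}^×`, where `i + l ≠ j` -/
  | generic (i j l : ℕ) (hi : 1 ≤ i) (hij : i < j) (hl : 1 ≤ l) (hlj : l < j)
      (hj : (j : ℕ∞) < len A) (hne : i + l ≠ j)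
      (a : (Trunc A (min (eps i j l : ℕ∞) (len A - j)))ˣ) : M2Param
  /-- a point of `A_{min (ε + δ, k - j)}^{×,δ}`, where `i + l = j` and `0 ≤ δ ≤ k - j` -/
  | special (i j l : ℕ) (hi : 1 ≤ i) (hij : i < j) (hl : 1 ≤ l) (hlj : l < j)
      (hj : (j : ℕ∞) < len A) (heq : i + l = j) (δ : ℕ∞) (hδ : δ ≤ len A - j)
      (a : unitsDelta A (min ((eps i j l : ℕ∞) + δ) (len A - j)) δ) : M2Param
  /-- a point of the discrete set -/
  | discrete (t : discreteSet (len A)) : M2Param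

/-- The disjoint union which parametrises `B \ GL_3(A) / B`, with one constructor for each
element of `S_3`. -/
inductive GL3Param : Type u
  | fib_one (o : M2Orbits A) : GL3Param
  | fib_s1 (p : vp A × vp A) : GL3Param
  | fib_s2 (p : vp A × vp A) : GL3Param
  | fib_s1s2 (i : vp A) : GL3Param
  | fib_s2s1 (i : vp A) : GL3Param
  | fib_s1s2s1 : GL3Param

end Local

/-- The simple reflection `s_1`. -/
def s1 : Equiv.Perm (Fin 3) := Equiv.swap 0 1

/-- The simple reflection `s_2`. -/
def s2 : Equiv.Perm (Fin 3) := Equiv.swap 1 2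

/-- The permutation over which a point of the parameter space lies. -/
def GL3Param.perm {A : Type u} [CommRing A] [IsLocalRing A] : GL3Param A → Equiv.Perm (Fin 3)
  | .fib_one _ => 1
  | .fib_s1 _ => s1
  | .fib_s2 _ => s2
  | .fib_s1s2 _ => s1 * s2
  | .fib_s2s1 _ => s2 * s1
  | .fib_s1s2s1 => s1 * s2 * s1

end LocalBruhat

/-! Indices start at 0. Triangular factors act on the lower left 2×2 block α of g by triangular row
and column operations. Conversely α determines BgB: modulo the rows of α, the first two entries of
the top row of g generate A², and two generators of a cyclic module over a local ring differ by a
unit. So a triangular left factor makes the first two columns of two such matrices agree, and what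
remains is an upper triangular right factor (`cosetOf_eq_iff_bEquiv`). The problem becomes the
classification of α up to `BEquiv`.

Up to units, α₁₀ and det α are invariant, and the element of S₃ is read off from which of α₁₀, α₀₀,
α₁₁, det α are units. If α₁₀ or a diagonal entry is a unit, pivoting leaves only α₁₀ and det α, and
their valuations decide (`bEquiv_of_v_eq_of_isUnit`).

If only α₀₁ is a unit, let i, j, l be the valuations of α₀₀, α₁₀, α₁₁. A diagonal entry divisible by
α₁₀ can be cleared. As soon as some entry vanishes, diagonal scaling absorbs all units and the
valuations decide (`bEquiv_of_v_eq`). Otherwise i, l < j < k and scaling leaves one unit a. Then a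
and a' give the same orbit iff π^j(a' - a) lies in the ideal generated by π^j(π^(j-l)a - π^i) and
π^j(π^(j-i)a - π^l) (`bEquiv_genMat_iff`). For i + l ≠ j these brackets have minimal valuation ε.
For i + l = j both are powers of π times a - 1, which is why δ = v(a - 1) enters. -/

namespace LocalBruhat

/-! ### Triangular equivalence and the passage from GL₃ to the lower left block -/

section Orbits

variable {R : Type*} [CommRing R]

/-- Equivalence of `2 × 2` matrices under upper triangular row and column operations. -/
def BEquiv (α β : Matrix (Fin 2) (Fin 2) R) : Prop :=
  ∃ b ∈ borel 2 R, ∃ c ∈ borel 2 R, β = b.1 * α * c.1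

theorem mem_borel_two {b : GL (Fin 2) R} (hb : b ∈ borel 2 R) :
    ∃ (x y : Rˣ) (t : R), b.1 = !![x.1, t; 0, y.1] := by
  have h0 : b.1 1 0 = 0 := hb 1 0 (by decide)
  have h : IsUnit b.1.det := (Matrix.isUnit_iff_isUnit_det _).1 b.isUnit
  rw [Matrix.det_fin_two, h0, mul_zero, sub_zero] at h
  refine ⟨(isUnit_of_mul_isUnit_left h).unit, (isUnit_of_mul_isUnit_right h).unit, b.1 0 1, ?_⟩
  ext i j
  fin_cases i <;> fin_cases j <;> simp [h0]

/-- The invertible upper triangular `2 × 2` matrix with the given entries. -/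
noncomputable def upperTwo (x y : Rˣ) (t : R) : GL (Fin 2) R :=
  Matrix.GeneralLinearGroup.mk'' !![x.1, t; 0, y.1] (by simp [Matrix.det_fin_two])

theorem upperTwo_mem (x y : Rˣ) (t : R) : upperTwo x y t ∈ borel 2 R := by
  intro i j h
  fin_cases i <;> fin_cases j <;> first | rfl | exact absurd h (by decide)

/-- Here `b₁`, `b₂`, `t` are the entries of the left factor and `c₁`, `c₂`, `s` those of the right
one. In this form equivalences are produced and exploited by ring identities. -/
theorem bEquiv_iff {α β : Matrix (Fin 2) (Fin 2) R} :
    BEquiv α β ↔ ∃ (b₁ b₂ c₁ c₂ : Rˣ) (t s : R),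
      β 0 0 = (b₁ * α 0 0 + t * α 1 0) * c₁ ∧
      β 0 1 = (b₁ * α 0 0 + t * α 1 0) * s + (b₁ * α 0 1 + t * α 1 1) * c₂ ∧
      β 1 0 = b₂ * α 1 0 * c₁ ∧
      β 1 1 = b₂ * α 1 0 * s + b₂ * α 1 1 * c₂ := by
  have key : ∀ (b₁ b₂ c₁ c₂ : Rˣ) (t s : R),
      β = !![b₁.1, t; 0, b₂.1] * α * !![c₁.1, s; 0, c₂.1] ↔
      (β 0 0 = (b₁ * α 0 0 + t * α 1 0) * c₁ ∧
      β 0 1 = (b₁ * α 0 0 + t * α 1 0) * s + (b₁ * α 0 1 + t * α 1 1) * c₂ ∧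
      β 1 0 = b₂ * α 1 0 * c₁ ∧
      β 1 1 = b₂ * α 1 0 * s + b₂ * α 1 1 * c₂) := by
    intro b₁ b₂ c₁ c₂ t s
    rw [← Matrix.ext_iff]
    simp only [Fin.forall_fin_two, Matrix.mul_apply, Fin.sum_univ_two]
    simp [and_assoc]
  constructor
  · rintro ⟨b, hb, c, hc, h⟩
    obtain ⟨b₁, b₂, t, hb⟩ := mem_borel_two hb
    obtain ⟨c₁, c₂, s, hc⟩ := mem_borel_two hc
    rw [hb, hc] at h
    exact ⟨b₁, b₂, c₁, c₂, t, s, (key ..).1 h⟩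
  · rintro ⟨b₁, b₂, c₁, c₂, t, s, h⟩
    exact ⟨_, upperTwo_mem b₁ b₂ t, _, upperTwo_mem c₁ c₂ s, (key ..).2 h⟩

theorem BEquiv.refl (α : Matrix (Fin 2) (Fin 2) R) : BEquiv α α :=
  ⟨1, one_mem _, 1, one_mem _, by simp⟩

theorem BEquiv.symm {α β : Matrix (Fin 2) (Fin 2) R} (h : BEquiv α β) : BEquiv β α := by
  obtain ⟨b, hb, c, hc, h⟩ := h
  refine ⟨b⁻¹, inv_mem hb, c⁻¹, inv_mem hc, ?_⟩
  rw [h, ← mul_assoc, ← mul_assoc, Units.inv_mul, one_mul, mul_assoc, Units.mul_inv, mul_one]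

theorem BEquiv.trans {α β γ : Matrix (Fin 2) (Fin 2) R} (h : BEquiv α β) (h' : BEquiv β γ) :
    BEquiv α γ := by
  obtain ⟨b, hb, c, hc, h⟩ := h
  obtain ⟨b', hb', c', hc', h'⟩ := h'
  refine ⟨b' * b, mul_mem hb' hb, c * c', mul_mem hc hc', ?_⟩
  rw [h', h]
  simp only [Units.val_mul, mul_assoc]

theorem BEquiv.det {α β : Matrix (Fin 2) (Fin 2) R} (h : BEquiv α β) :
    ∃ u : Rˣ, β.det = u * α.det := by
  obtain ⟨b, -, c, -, h⟩ := h
  refine ⟨Matrix.GeneralLinearGroup.det b * Matrix.GeneralLinearGroup.det c, ?_⟩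
  rw [h, Matrix.det_mul, Matrix.det_mul]
  simp only [Units.val_mul, Matrix.GeneralLinearGroup.val_det_apply]
  ring

theorem BEquiv.apply_one_zero {α β : Matrix (Fin 2) (Fin 2) R} (h : BEquiv α β) :
    ∃ u : Rˣ, β 1 0 = u * α 1 0 := by
  obtain ⟨b₁, b₂, c₁, c₂, t, s, -, -, h, -⟩ := bEquiv_iff.1 h
  exact ⟨b₂ * c₁, by rw [h, Units.val_mul]; ring⟩

/-- The lower left `2 × 2` submatrix. -/
def lowerLeft (g : GL (Fin 3) R) : Matrix (Fin 2) (Fin 2) R := g.1.submatrix ![1, 2] ![0, 1]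

theorem isUnit_diag_of_mem_borel {b : GL (Fin 3) R} (hb : b ∈ borel 3 R) (i : Fin 3) :
    IsUnit (b.1 i i) := by
  have h : IsUnit b.1.det := (Matrix.isUnit_iff_isUnit_det _).1 b.isUnit
  rw [Matrix.det_of_isUpperTriangular (fun i j h => hb i j h), IsUnit.prod_univ_iff] at h
  exact h i

/-- By triangularity the last two rows and the first two columns of a product involve only the lower
right block of `b` and the upper left block of `c`. -/
theorem bEquiv_lowerLeft_mul (b g c : GL (Fin 3) R) (hb : b ∈ borel 3 R) (hc : c ∈ borel 3 R) :
    BEquiv (lowerLeft g) (lowerLeft (b * g * c)) := by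
  have b1 : b.1 1 0 = 0 := hb 1 0 (by decide)
  have b2 : b.1 2 0 = 0 := hb 2 0 (by decide)
  have b3 : b.1 2 1 = 0 := hb 2 1 (by decide)
  have c1 : c.1 1 0 = 0 := hc 1 0 (by decide)
  have c2 : c.1 2 0 = 0 := hc 2 0 (by decide)
  have c3 : c.1 2 1 = 0 := hc 2 1 (by decide)
  refine bEquiv_iff.2 ⟨(isUnit_diag_of_mem_borel hb 1).unit, (isUnit_diag_of_mem_borel hb 2).unit,
    (isUnit_diag_of_mem_borel hc 0).unit, (isUnit_diag_of_mem_borel hc 1).unit,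
    b.1 1 2, c.1 0 1, ?_⟩
  simp [lowerLeft, Matrix.mul_apply, Fin.sum_univ_three, b1, b2, b3, c1, c2, c3]

theorem mem_borel_three {b : GL (Fin 3) R} {x y z p q r : R}
    (h : b.1 = !![x, p, q; 0, y, r; 0, 0, z]) : b ∈ borel 3 R := by
  intro i j hij
  rw [h]
  fin_cases i <;> fin_cases j <;> first | rfl | exact absurd hij (by decide)

theorem cosetOf_eq_iff {g g' : GL (Fin 3) R} :
    cosetOf g = cosetOf g' ↔ ∃ b ∈ borel 3 R, ∃ c ∈ borel 3 R, g' = b * g * c :=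
  DoubleCoset.eq (borel 3 R) (borel 3 R) g g'

/-- Two generators of a cyclic quotient of `R ^ 2` over a local ring differ by a unit. -/
theorem exists_unit_row [IsLocalRing R] (α : Matrix (Fin 2) (Fin 2) R) (p p' : Fin 2 → R)
    (h : ∃ (c : R) (r : Fin 2 → R), p' = c • p + Matrix.vecMul r α)
    (h' : ∃ (c : R) (r : Fin 2 → R), p = c • p' + Matrix.vecMul r α) :
    ∃ (u : Rˣ) (r : Fin 2 → R), p' = u.1 • p + Matrix.vecMul r α := by
  obtain ⟨c, r, h⟩ := h
  obtain ⟨c', r', h'⟩ := h'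
  by_cases hc : IsUnit c
  · exact ⟨hc.unit, r, h⟩
  have h1 : IsUnit (1 - c' * c) :=
    IsLocalRing.isUnit_one_sub_self_of_mem_nonunits _
      (fun h => hc (isUnit_of_mul_isUnit_right h))
  obtain ⟨w, hw⟩ := h1
  -- Substituting one relation into the other gives `(1 - c' * c) • p` in the row span of `α`. As
  -- this factor is a unit, `p` itself is zero in the quotient, and the coefficient `c` may be
  -- replaced by 1.
  have hp : p = Matrix.vecMul (w⁻¹.1 • (c' • r + r')) α := by
    have : w.1 • p = Matrix.vecMul (c' • r + r') α := by
      rw [hw, sub_smul, one_smul, Matrix.add_vecMul, Matrix.smul_vecMul]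
      nth_rewrite 1 [h']
      rw [h, smul_add, mul_smul]
      abel
    rw [Matrix.smul_vecMul, ← this, smul_smul, Units.inv_mul, one_smul]
  refine ⟨1, (c - 1) • (w⁻¹.1 • (c' • r + r')) + r, ?_⟩
  rw [Matrix.add_vecMul, Matrix.smul_vecMul, ← hp, h, Units.val_one, one_smul, sub_smul, one_smul]
  abel

/-- The rows of `g` span `R ^ 3`, so their truncations to two entries span `R ^ 2`. Hence the
truncated top row generates `R ^ 2` modulo the rows of the block. -/
theorem exists_row_eq (g : GL (Fin 3) R) (q : Fin 2 → R) :
    ∃ (c : R) (r : Fin 2 → R),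
      q = c • (fun j => g.1 0 (![0, 1] j)) + Matrix.vecMul r (lowerLeft g) := by
  set w : Fin 3 → R := Matrix.vecMul ![q 0, q 1, 0] g⁻¹.1 with hw
  have h : Matrix.vecMul w g.1 = ![q 0, q 1, 0] := by
    rw [hw, Matrix.vecMul_vecMul, Units.inv_mul, Matrix.vecMul_one]
  refine ⟨w 0, ![w 1, w 2], ?_⟩
  have h0 := congr_fun h 0
  have h1 := congr_fun h 1
  simp only [Matrix.vecMul, dotProduct, Fin.sum_univ_three] at h0 h1
  ext j
  simp only [Pi.add_apply, Pi.smul_apply, smul_eq_mul, Matrix.vecMul, dotProduct,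
    Fin.sum_univ_two]
  fin_cases j
  · exact h0.symm.trans (add_assoc _ _ _)
  · exact h1.symm.trans (add_assoc _ _ _)

theorem cosetOf_eq_of_lowerLeft_eq [IsLocalRing R] {g g' : GL (Fin 3) R}
    (h : lowerLeft g = lowerLeft g') : cosetOf g = cosetOf g' := by
  obtain ⟨u, r, hr⟩ := exists_unit_row (lowerLeft g) _ _
    (exists_row_eq g (fun j => g'.1 0 (![0, 1] j)))
    (by rw [h]; exact exists_row_eq g' (fun j => g.1 0 (![0, 1] j)))
  let b : GL (Fin 3) R := Matrix.GeneralLinearGroup.mk'' !![u.1, r 0, r 1; 0, 1, 0; 0, 0, 1]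
    (by simp [Matrix.det_fin_three])
  have hb : b ∈ borel 3 R := mem_borel_three rfl
  have hcol : ∀ (i : Fin 3) (j : Fin 2), (b * g).1 i (![0, 1] j) = g'.1 i (![0, 1] j) := by
    intro i j
    have e1 := congr_fun hr j
    have e2 := congr_fun (congr_fun h 0) j
    have e3 := congr_fun (congr_fun h 1) j
    have hbv : b.1 = !![u.1, r 0, r 1; 0, 1, 0; 0, 0, 1] := rfl
    simp only [Pi.add_apply, Pi.smul_apply, smul_eq_mul, Matrix.vecMul, dotProduct,
      Fin.sum_univ_two] at e1
    rw [Units.val_mul, hbv, Matrix.mul_apply, Fin.sum_univ_three]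
    fin_cases i
    · exact (add_assoc _ _ _).trans e1.symm
    · change 0 * g.1 0 _ + 1 * g.1 1 _ + 0 * g.1 2 _ = _
      rw [zero_mul, zero_mul, one_mul, zero_add, add_zero]
      exact e2
    · change 0 * g.1 0 _ + 0 * g.1 1 _ + 1 * g.1 2 _ = _
      rw [zero_mul, zero_mul, one_mul, zero_add, zero_add]
      exact e3
  -- Since `b * g` and `g'` share their first two columns, those of the right factor are columns of
  -- the identity. Triangularity imposes nothing on the third.
  refine cosetOf_eq_iff.2 ⟨b, hb, (b * g)⁻¹ * g', ?_, by group⟩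
  have h1 : (b * g)⁻¹.1 * (b * g).1 = 1 := Units.inv_mul _
  have hent : ∀ (i : Fin 3) (j : Fin 2),
      ((b * g)⁻¹ * g').1 i (![0, 1] j) = (1 : Matrix (Fin 3) (Fin 3) R) i (![0, 1] j) := by
    intro i j
    rw [← h1, Units.val_mul, Matrix.mul_apply, Matrix.mul_apply]
    simp only [hcol]
  intro i j hij
  have := hent i
  fin_cases j
  · exact (this 0).trans (Matrix.one_apply_ne hij.ne')
  · exact (this 1).trans (Matrix.one_apply_ne hij.ne')
  · exact absurd hij (by fin_cases i <;> decide)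

/-- For the converse the 2×2 factors are bordered by 1 to triangular 3×3 matrices. This moves `g` to
a matrix with the same block as `g'`. -/
theorem cosetOf_eq_iff_bEquiv [IsLocalRing R] {g g' : GL (Fin 3) R} :
    cosetOf g = cosetOf g' ↔ BEquiv (lowerLeft g) (lowerLeft g') := by
  constructor
  · intro h
    obtain ⟨b, hb, c, hc, rfl⟩ := cosetOf_eq_iff.1 h
    exact bEquiv_lowerLeft_mul b g c hb hc
  · intro h
    obtain ⟨b₁, b₂, c₁, c₂, t, s, h1, h2, h3, h4⟩ := bEquiv_iff.1 h
    let b : GL (Fin 3) R := Matrix.GeneralLinearGroup.mk'' !![1, 0, 0; 0, b₁.1, t; 0, 0, b₂.1]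
      (by simp [Matrix.det_fin_three])
    have hb : b ∈ borel 3 R := mem_borel_three rfl
    let c : GL (Fin 3) R := Matrix.GeneralLinearGroup.mk'' !![c₁.1, s, 0; 0, c₂.1, 0; 0, 0, 1]
      (by simp [Matrix.det_fin_three])
    have hc : c ∈ borel 3 R := mem_borel_three rfl
    refine (cosetOf_eq_iff.2 ⟨b, hb, c, hc, rfl⟩).trans (cosetOf_eq_of_lowerLeft_eq ?_)
    have hbv : b.1 = !![1, 0, 0; 0, b₁.1, t; 0, 0, b₂.1] := rfl
    have hcv : c.1 = !![c₁.1, s, 0; 0, c₂.1, 0; 0, 0, 1] := rfl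
    simp only [lowerLeft, Matrix.submatrix_apply] at h1 h2 h3 h4
    ext i j
    simp only [lowerLeft, Units.val_mul, Matrix.submatrix_apply]
    fin_cases i <;> fin_cases j
    · exact Eq.trans (by simp only [hbv, hcv, Matrix.mul_apply, Fin.sum_univ_three]; simp) h1.symm
    · exact Eq.trans (by simp only [hbv, hcv, Matrix.mul_apply, Fin.sum_univ_three]; simp) h2.symm
    · exact Eq.trans (by simp only [hbv, hcv, Matrix.mul_apply, Fin.sum_univ_three]; simp) h3.symm
    · exact Eq.trans (by simp only [hbv, hcv, Matrix.mul_apply, Fin.sum_univ_three]; simp) h4.symm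

end Orbits

/-! ### Valuations in a local principal ideal ring and in its truncations -/

section LocalPIR

variable {A : Type*} [CommRing A] [IsLocalRing A]

theorem pow_maximalIdeal_eq {π : A} (hπ : Ideal.span {π} = maximalIdeal A) (n : ℕ) :
    maximalIdeal A ^ n = Ideal.span {π ^ n} := by
  rw [← hπ, Ideal.span_singleton_pow]

theorem mem_pow_iff {π : A} (hπ : Ideal.span {π} = maximalIdeal A) {n : ℕ} {x : A} :
    x ∈ maximalIdeal A ^ n ↔ π ^ n ∣ x := by
  rw [pow_maximalIdeal_eq hπ, Ideal.mem_span_singleton]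

theorem not_isUnit_uniformizer {π : A} (hπ : Ideal.span {π} = maximalIdeal A) : ¬ IsUnit π := by
  have : π ∈ maximalIdeal A := hπ ▸ Ideal.mem_span_singleton_self π
  exact this

theorem pow_eq_zero_iff_len_le {π : A} (hπ : Ideal.span {π} = maximalIdeal A) {n : ℕ} :
    π ^ n = 0 ↔ len A ≤ n := by
  have h : ∀ m : ℕ, maximalIdeal A ^ m = ⊥ ↔ π ^ m = 0 := fun m => by
    rw [pow_maximalIdeal_eq hπ, Ideal.span_singleton_eq_bot]
  constructor
  · intro hn
    exact iInf₂_le n ((h n).2 hn)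
  · intro hn
    by_contra h0
    have : ((n + 1 : ℕ) : ℕ∞) ≤ len A := by
      refine le_iInf₂ fun m hm => ?_
      rw [h] at hm
      norm_cast
      by_contra hlt
      exact h0 (pow_eq_zero_of_le (by omega) hm)
    have := this.trans hn
    norm_cast at this
    omega

theorem v_zero : v (0 : A) = len A := by simp [v, val, len]

theorem v_unit_mul_pow {π : A} (hπ : Ideal.span {π} = maximalIdeal A) (u : Aˣ) (n : ℕ) :
    v (u * π ^ n) = min (n : ℕ∞) (len A) := by
  by_cases h : π ^ n = 0
  · rw [h, mul_zero, v_zero, min_eq_right ((pow_eq_zero_iff_len_le hπ).1 h)]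
  · have hlt : (n : ℕ∞) < len A := not_le.1 (fun h' => h ((pow_eq_zero_iff_len_le hπ).2 h'))
    rw [min_eq_left hlt.le, v, val, if_neg (by simpa using h)]
    refine le_antisymm (iSup₂_le fun m hm => ?_) ?_
    · rw [mem_pow_iff hπ] at hm
      norm_cast
      by_contra hmn
      -- If `π ^ n = π ^ n * π * c`, then `π ^ n` is killed by the unit `1 - π * c`.
      have hd : π ^ n * π ∣ π ^ n := by
        rw [← pow_succ]
        exact (pow_dvd_pow π (by omega)).trans ((Units.dvd_mul_left).1 hm)
      obtain ⟨c, hc⟩ := hd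
      have hu : IsUnit (1 - π * c) := isUnit_one_sub_self_of_mem_nonunits _
        (fun hu => not_isUnit_uniformizer hπ (isUnit_of_mul_isUnit_left hu))
      exact h ((hu.mul_left_eq_zero).1 (by linear_combination hc))
    · exact le_iSup₂_of_le (f := fun (m : ℕ) (_ : u * π ^ n ∈ maximalIdeal A ^ m) => (m : ℕ∞)) n
        ((mem_pow_iff hπ).2 (dvd_mul_left _ _)) le_rfl

theorem v_pow {π : A} (hπ : Ideal.span {π} = maximalIdeal A) (n : ℕ) :
    v (π ^ n) = min (n : ℕ∞) (len A) := by
  simpa using v_unit_mul_pow hπ 1 n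

/-- Krull's intersection theorem bounds the powers of `π` dividing `x ≠ 0`. The cofactor of the
largest one is not divisible by `π`, hence is a unit. -/
theorem exists_eq_unit_mul_pow [IsNoetherianRing A] {π : A}
    (hπ : Ideal.span {π} = maximalIdeal A) {x : A} (hx : x ≠ 0) :
    ∃ (u : Aˣ) (n : ℕ), x = u * π ^ n ∧ (n : ℕ∞) < len A := by
  classical
  have hex : ∃ n, ¬ π ^ n ∣ x := by
    by_contra! hall
    have : x ∈ ⨅ n, maximalIdeal A ^ n := by
      simp only [Ideal.mem_iInf]
      exact fun n => (mem_pow_iff hπ).2 (hall n)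
    rw [Ideal.iInf_pow_eq_bot_of_isLocalRing _ (Ideal.IsPrime.ne_top')] at this
    exact hx (by simpa using this)
  have hpos : Nat.find hex ≠ 0 := by
    intro h0
    have := Nat.find_spec hex
    rw [h0] at this
    simp at this
  obtain ⟨n, hn⟩ := Nat.exists_eq_succ_of_ne_zero hpos
  have h1 : π ^ n ∣ x := by
    by_contra h
    have := Nat.find_min' hex h
    omega
  have h2 : ¬ π ^ (n + 1) ∣ x := by
    have := Nat.find_spec hex
    rwa [hn] at this
  obtain ⟨c, rfl⟩ := h1
  have hc : IsUnit c := by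
    by_contra hc
    have hc : c ∈ maximalIdeal A := hc
    rw [← hπ, Ideal.mem_span_singleton] at hc
    exact h2 (by rw [pow_succ]; exact mul_dvd_mul_left _ hc)
  refine ⟨hc.unit, n, by simp [mul_comm], not_le.1 fun h => hx ?_⟩
  rw [(pow_eq_zero_iff_len_le hπ).2 h, zero_mul]

theorem len_pos : 0 < len A := by
  rw [pos_iff_ne_zero]
  intro h
  have : (1 : ℕ∞) ≤ len A := by
    refine le_iInf₂ fun n hn => ?_
    rcases n with _ | n
    · simp [Ideal.one_eq_top] at hn
    · simp
  rw [h] at this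
  simp at this

theorem iInf_natCast_of_le (m : ℕ∞) : ⨅ (n : ℕ) (_ : m ≤ n), (n : ℕ∞) = m := by
  refine le_antisymm ?_ (le_iInf₂ fun n hn => hn)
  rcases eq_or_ne m ⊤ with rfl | hne
  · exact le_top
  · lift m to ℕ using hne
    exact iInf₂_le (f := fun (n : ℕ) (_ : (m : ℕ∞) ≤ n) => (n : ℕ∞)) m le_rfl

theorem iSup_natCast_of_le (m : ℕ∞) : ⨆ (n : ℕ) (_ : (n : ℕ∞) ≤ m), (n : ℕ∞) = m := by
  refine le_antisymm (iSup₂_le fun n hn => hn) ?_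
  rcases eq_or_ne m ⊤ with rfl | hne
  · refine ENat.forall_natCast_le_iff_le.1 fun a _ => ?_
    exact le_iSup₂_of_le (f := fun (n : ℕ) (_ : (n : ℕ∞) ≤ ⊤) => (n : ℕ∞)) a le_top le_rfl
  · lift m to ℕ using hne
    exact le_iSup₂_of_le (f := fun (n : ℕ) (_ : (n : ℕ∞) ≤ (m : ℕ∞)) => (n : ℕ∞)) m le_rfl le_rfl

variable [IsNoetherianRing A]

theorem v_le_len {π : A} (hπ : Ideal.span {π} = maximalIdeal A) (x : A) : v x ≤ len A := by
  by_cases hx : x = 0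
  · rw [hx, v_zero]
  · obtain ⟨u, n, rfl, -⟩ := exists_eq_unit_mul_pow hπ hx
    rw [v_unit_mul_pow hπ]
    exact min_le_right _ _

theorem v_eq_len_iff {π : A} (hπ : Ideal.span {π} = maximalIdeal A) {x : A} :
    v x = len A ↔ x = 0 := by
  refine ⟨fun h => ?_, fun h => h ▸ v_zero⟩
  by_contra hx
  obtain ⟨u, n, rfl, hn⟩ := exists_eq_unit_mul_pow hπ hx
  rw [v_unit_mul_pow hπ, min_eq_left hn.le] at h
  exact hn.ne h

theorem dvd_iff_v_le {π : A} (hπ : Ideal.span {π} = maximalIdeal A) {x y : A} :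
    x ∣ y ↔ v x ≤ v y := by
  by_cases hy : y = 0
  · simp [hy, v_zero, v_le_len hπ]
  by_cases hx : x = 0
  · rw [hx, v_zero, zero_dvd_iff, ← v_eq_len_iff hπ]
    exact ⟨fun h => h.ge, fun h => le_antisymm (v_le_len hπ y) h⟩
  obtain ⟨u, n, rfl, hn⟩ := exists_eq_unit_mul_pow hπ hx
  obtain ⟨w, m, rfl, hm⟩ := exists_eq_unit_mul_pow hπ hy
  rw [v_unit_mul_pow hπ, v_unit_mul_pow hπ, min_eq_left hn.le, min_eq_left hm.le,
    Units.mul_left_dvd, Units.dvd_mul_left]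
  constructor
  · intro h
    by_contra hlt
    push Not at hlt
    norm_cast at hlt
    obtain ⟨c, hc⟩ := (pow_dvd_pow π (Nat.succ_le_of_lt hlt)).trans h
    have hu : IsUnit (1 - π * c) := isUnit_one_sub_self_of_mem_nonunits _
      (fun hu => not_isUnit_uniformizer hπ (isUnit_of_mul_isUnit_left hu))
    have : π ^ m = 0 := (hu.mul_left_eq_zero).1 (by
      rw [Nat.succ_eq_add_one, pow_succ] at hc
      linear_combination hc)
    exact hy (by rw [this, mul_zero])
  · intro h
    exact pow_dvd_pow π (by exact_mod_cast h)

theorem v_eq_iff {π : A} (hπ : Ideal.span {π} = maximalIdeal A) {x y : A} :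
    v x = v y ↔ ∃ u : Aˣ, y = u * x := by
  constructor
  · intro h
    by_cases hx : x = 0
    · rw [hx, v_zero] at h
      exact ⟨1, by rw [(v_eq_len_iff hπ).1 h.symm, hx, mul_zero]⟩
    have hy : y ≠ 0 := by
      rintro rfl
      rw [v_zero] at h
      exact hx ((v_eq_len_iff hπ).1 h)
    obtain ⟨u, n, rfl, hn⟩ := exists_eq_unit_mul_pow hπ hx
    obtain ⟨w, m, rfl, hm⟩ := exists_eq_unit_mul_pow hπ hy
    rw [v_unit_mul_pow hπ, v_unit_mul_pow hπ, min_eq_left hn.le, min_eq_left hm.le] at h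
    have h : n = m := by exact_mod_cast h
    subst h
    exact ⟨w * u⁻¹, by rw [Units.val_mul, mul_assoc, Units.inv_mul_cancel_left]⟩
  · rintro ⟨u, rfl⟩
    exact le_antisymm ((dvd_iff_v_le hπ).1 (dvd_mul_left _ _))
      ((dvd_iff_v_le hπ).1 (Units.mul_left_dvd.2 dvd_rfl))

theorem v_unit_mul {π : A} (hπ : Ideal.span {π} = maximalIdeal A) (u : Aˣ) (x : A) :
    v (u * x) = v x :=
  ((v_eq_iff hπ).2 ⟨u, rfl⟩).symm

theorem v_eq_zero_iff {π : A} (hπ : Ideal.span {π} = maximalIdeal A) {x : A} :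
    v x = 0 ↔ IsUnit x := by
  have h1 : v (1 : A) = 0 := by
    have := v_pow hπ 0
    simpa using this
  constructor
  · intro h
    exact isUnit_of_dvd_one ((dvd_iff_v_le hπ).2 (by rw [h]; exact zero_le))
  · intro h
    exact le_antisymm (h1 ▸ (dvd_iff_v_le hπ).1 h.dvd) zero_le

theorem one_le_v_iff {π : A} (hπ : Ideal.span {π} = maximalIdeal A) {x : A} :
    1 ≤ v x ↔ ¬ IsUnit x := by
  rw [← v_eq_zero_iff hπ, Order.one_le_iff_ne_zero]

theorem v_pow_mul {π : A} (hπ : Ideal.span {π} = maximalIdeal A) (n : ℕ) (x : A) :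
    v (π ^ n * x) = min (n + v x) (len A) := by
  by_cases hx : x = 0
  · rw [hx, mul_zero, v_zero, min_eq_right le_add_self]
  · obtain ⟨u, m, rfl, hm⟩ := exists_eq_unit_mul_pow hπ hx
    rw [mul_left_comm, ← pow_add, v_unit_mul_pow hπ, v_unit_mul_pow hπ, min_eq_left hm.le]
    push_cast
    rfl

/-- The bound `m ≤ len A` is essential: beyond the length the ideal still contains 0, but no
valuation reaches `m`. -/
theorem mem_powIdeal {π : A} (hπ : Ideal.span {π} = maximalIdeal A) {m : ℕ∞} (hm : m ≤ len A)
    {x : A} : x ∈ powIdeal A m ↔ m ≤ v x := by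
  rcases eq_or_ne m ⊤ with rfl | hne
  · have hk : len A = ⊤ := top_le_iff.1 hm
    rw [powIdeal, if_pos rfl, Ideal.mem_bot, ← v_eq_len_iff hπ, hk, top_le_iff]
  · lift m to ℕ using hne
    rw [powIdeal, if_neg (ENat.natCast_ne_top _), ENat.toNat_natCast, mem_pow_iff hπ,
      dvd_iff_v_le hπ, v_pow hπ, min_eq_left hm]

theorem unitMod_eq_iff {π : A} (hπ : Ideal.span {π} = maximalIdeal A) {m : ℕ∞} (hm : m ≤ len A)
    {a b : Aˣ} : unitMod m a = unitMod m b ↔ m ≤ v (b.1 - a.1) := by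
  rw [← mem_powIdeal hπ hm, eq_comm, Units.ext_iff, ← Ideal.Quotient.mk_eq_mk_iff_sub_mem]
  rfl

theorem unitMod_surjective {π : A} (hπ : Ideal.span {π} = maximalIdeal A) {m : ℕ∞}
    (hm : m ≤ len A) (h1 : 1 ≤ m) : Function.Surjective (unitMod (A := A) m) := by
  intro a
  obtain ⟨x, hx⟩ := Ideal.Quotient.mk_surjective a.1
  obtain ⟨y, hy⟩ := Ideal.Quotient.mk_surjective a⁻¹.1
  have hxy : x * y - 1 ∈ powIdeal A m := by
    rw [← Ideal.Quotient.mk_eq_mk_iff_sub_mem, map_mul, hx, hy, map_one, Units.mul_inv]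
  have hu : IsUnit x := by
    rw [mem_powIdeal hπ hm] at hxy
    -- As `m ≥ 1`, the product `x * y` is 1 modulo the maximal ideal, so every lift `x` of a unit is
    -- a unit.
    have h2 := (one_le_v_iff hπ).1 (h1.trans hxy)
    by_contra hx
    have : IsUnit (1 - x * y) := isUnit_one_sub_self_of_mem_nonunits _
        (fun hu => hx (isUnit_of_mul_isUnit_left hu))
    exact h2 (by rw [← neg_sub]; exact this.neg)
  exact ⟨hu.unit, Units.ext hx⟩

theorem val_map_mk {π : A} (hπ : Ideal.span {π} = maximalIdeal A) {m : ℕ∞} (hm : m ≤ len A)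
    (x : A) :
    val ((maximalIdeal A).map (Ideal.Quotient.mk (powIdeal A m)))
      (Ideal.Quotient.mk (powIdeal A m) x) = min (v x) m := by
  have hdvd : ∀ (n : ℕ) (y : A), Ideal.Quotient.mk (powIdeal A m) y ∈
      (maximalIdeal A).map (Ideal.Quotient.mk (powIdeal A m)) ^ n ↔ min (n : ℕ∞) m ≤ v y := by
    intro n y
    rw [← Ideal.map_pow, Ideal.mem_map_iff_of_surjective _ Ideal.Quotient.mk_surjective]
    constructor
    · rintro ⟨z, hz, hzy⟩
      rw [Ideal.Quotient.mk_eq_mk_iff_sub_mem, mem_powIdeal hπ hm] at hzy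
      rw [mem_pow_iff hπ, dvd_iff_v_le hπ, v_pow hπ] at hz
      -- Divisibility is total, so `y = z - (z - y)` is a multiple of `z` or of `z - y`.
      obtain ⟨c, hc⟩ | ⟨c, hc⟩ : z ∣ z - y ∨ z - y ∣ z := by
        simp only [dvd_iff_v_le hπ]
        exact le_total _ _
      · refine le_trans ?_ ((dvd_iff_v_le hπ).1 (⟨1 - c, by linear_combination -hc⟩ : z ∣ y))
        exact le_trans (min_le_min_left _ hm) hz
      · refine le_trans ?_ ((dvd_iff_v_le hπ).1 (⟨c - 1, by linear_combination hc⟩ : z - y ∣ y))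
        exact (min_le_right _ _).trans hzy
    · intro h
      rcases min_le_iff.1 h with h | h
      · refine ⟨y, ?_, rfl⟩
        rw [mem_pow_iff hπ, dvd_iff_v_le hπ, v_pow hπ]
        exact (min_le_left _ _).trans h
      · refine ⟨0, zero_mem _, ?_⟩
        rw [Ideal.Quotient.mk_eq_mk_iff_sub_mem, mem_powIdeal hπ hm, zero_sub,
          ← neg_one_mul]
        exact h.trans (v_unit_mul hπ (-1) y).ge
  -- On the zero class the valuation is by convention the length of the quotient, which has to be
  -- computed as `m`.
  by_cases h0 : Ideal.Quotient.mk (powIdeal A m) x = 0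
  · have hmx := (mem_powIdeal hπ hm).1 (Ideal.Quotient.eq_zero_iff_mem.1 h0)
    have hbot : ∀ n : ℕ, (maximalIdeal A).map (Ideal.Quotient.mk (powIdeal A m)) ^ n = ⊥ ↔
        m ≤ n := by
      intro n
      rw [← Ideal.map_pow, Ideal.map_eq_bot_iff_le_ker, Ideal.mk_ker, pow_maximalIdeal_eq hπ,
        Ideal.span_singleton_le_iff_mem, mem_powIdeal hπ hm, v_pow hπ, le_min_iff]
      exact and_iff_left hm
    rw [val, if_pos h0, nilLength, min_eq_right hmx]
    simp only [hbot]
    exact iInf_natCast_of_le m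
  · have hmx : v x < m := not_le.1 fun h => h0
      (Ideal.Quotient.eq_zero_iff_mem.2 ((mem_powIdeal hπ hm).2 h))
    rw [val, if_neg h0, min_eq_left hmx.le]
    have : ∀ n : ℕ, min (n : ℕ∞) m ≤ v x ↔ (n : ℕ∞) ≤ v x := fun n => by
      rw [min_le_iff, or_iff_left hmx.not_ge]
    simp only [hdvd, this]
    exact iSup_natCast_of_le (v x)

theorem unitMod_mem_unitsDelta_iff {π : A} (hπ : Ideal.span {π} = maximalIdeal A) {m δ : ℕ∞}
    (hm : m ≤ len A) (a : Aˣ) : unitMod m a ∈ unitsDelta A m δ ↔ min (v (a.1 - 1)) m = δ := by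
  rw [← val_map_mk hπ hm, map_sub, map_one]
  rfl

end LocalPIR

/-! ### When two units define the same orbit -/

section TwoByTwo

variable {A : Type*} [CommRing A]

/-- The matrix with entries `π ^ i`, `1`, `π ^ j * a`, `π ^ l`. -/
def genMat (π : A) (i j l : ℕ) (a : Aˣ) : Matrix (Fin 2) (Fin 2) A :=
  !![π ^ i, 1; π ^ j * a.1, π ^ l]

/-- The preserved diagonal entries say that, on multiples of `π ^ j`, the scalars `c₁` and `b₂` are
inverse to `b₁ + t π^r a` and `c₂ + s π^m a`. The lower left entry then relates `a` to `a'` times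
the product of these two factors, and the top right entry 1 evaluates that product as 1 plus a
combination of the two brackets. -/
theorem exists_of_bEquiv_genMat {π : A} {i j l m r : ℕ} (hr : j = i + r) (hm : j = l + m)
    {a a' : Aˣ} (h : BEquiv (genMat π i j l a) (genMat π i j l a')) :
    ∃ p q : A, π ^ j * (a'.1 - a.1) =
      π ^ j * (p * (π ^ m * a - π ^ i) + q * (π ^ r * a - π ^ l)) := by
  obtain ⟨b₁, b₂, c₁, c₂, t, s, h1, h2, h3, h4⟩ := bEquiv_iff.1 h
  simp only [genMat, Matrix.of_apply, Matrix.cons_val', Matrix.cons_val_zero,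
    Matrix.cons_val_one, Matrix.cons_val_fin_one] at h1 h2 h3 h4
  have er : π ^ j = π ^ i * π ^ r := by rw [hr, pow_add]
  have em : π ^ j = π ^ l * π ^ m := by rw [hm, pow_add]
  have f1 : π ^ j = c₁ * (b₁ + t * (π ^ r * a)) * π ^ j := by
    linear_combination (1 - c₁ * b₁) * er + π ^ r * h1
  have f2 : π ^ j = b₂ * (c₂ + s * (π ^ m * a)) * π ^ j := by
    linear_combination (1 - b₂ * c₂) * em + π ^ m * h4
  have f3 : π ^ j * a = π ^ j * a' * ((b₁ + t * (π ^ r * a)) * (c₂ + s * (π ^ m * a))) := by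
    rw [h3]
    linear_combination a * f1 + a * c₁ * (b₁ + t * (π ^ r * a)) * f2
  have f4 : (b₁ + t * (π ^ r * a)) * (c₂ + s * (π ^ m * a)) =
      1 + (b₁ * s + t * s * a * π ^ r) * (π ^ m * a - π ^ i) + t * c₂ * (π ^ r * a - π ^ l) := by
    linear_combination -h2 - t * s * a * er
  rw [f4] at f3
  exact ⟨-(a' * (b₁ * s + t * s * a * π ^ r)), -(a' * (t * c₂)), by linear_combination -f3⟩

variable [IsLocalRing A]

theorem isUnit_one_add_of_not_isUnit {x : A} (hx : ¬ IsUnit x) : IsUnit (1 + x) := by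
  have := isUnit_one_sub_self_of_mem_nonunits (-x) (fun h => hx (by simpa using h.neg))
  simpa using this

theorem not_isUnit_pow {π : A} (hπ : Ideal.span {π} = maximalIdeal A) {n : ℕ} (hn : 1 ≤ n) :
    ¬ IsUnit (π ^ n) := fun h =>
  not_isUnit_uniformizer hπ ((isUnit_pow_iff (by omega)).1 h)

theorem not_isUnit_pow_mul_sub_pow {π : A} (hπ : Ideal.span {π} = maximalIdeal A) {m n : ℕ}
    (hm : 1 ≤ m) (hn : 1 ≤ n) (a : A) : ¬ IsUnit (π ^ m * a - π ^ n) := by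
  have h1 : π ^ m ∈ maximalIdeal A := not_isUnit_pow hπ hm
  have h2 : π ^ n ∈ maximalIdeal A := not_isUnit_pow hπ hn
  exact Ideal.sub_mem _ (Ideal.mul_mem_right a _ h1) h2

theorem isUnit_unit_sub_pow {π : A} (hπ : Ideal.span {π} = maximalIdeal A) {n : ℕ} (hn : 1 ≤ n)
    (a : Aˣ) : IsUnit (a.1 - π ^ n) := by
  by_contra h
  have h1 : a.1 - π ^ n ∈ maximalIdeal A := h
  have h2 : π ^ n ∈ maximalIdeal A := not_isUnit_pow hπ hn
  have h3 : a.1 ∈ maximalIdeal A := by simpa using Ideal.add_mem _ h1 h2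
  exact h3 a.isUnit

/-- A column operation `s` realises multiples of the first bracket. Keeping the top right entry 1
forces `c₂ = 1 - s π^i`, keeping `π ^ l` suggests `b₂ = w⁻¹` with `w = 1 + s (π^m a - π^i)`, and the
lower left entry becomes `π ^ j * a'` for `s = -p / a'`. -/
theorem bEquiv_genMat_of_col {π : A} (hπ : Ideal.span {π} = maximalIdeal A) {i j l m : ℕ}
    (hi : 1 ≤ i) (hm : j = l + m) (hm1 : 1 ≤ m) {a a' : Aˣ} {p : A}
    (h : π ^ j * (a'.1 - a.1) = π ^ j * (p * (π ^ m * a - π ^ i))) :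
    BEquiv (genMat π i j l a) (genMat π i j l a') := by
  set s : A := -(p * a'⁻¹.1) with hs
  have em : π ^ j = π ^ l * π ^ m := by rw [hm, pow_add]
  have hsa : s * a' = -p := by rw [hs, neg_mul, mul_assoc, Units.inv_mul, mul_one]
  obtain ⟨w, hw⟩ := isUnit_one_add_of_not_isUnit (x := s * (π ^ m * a - π ^ i))
    fun h => not_isUnit_pow_mul_sub_pow hπ hm1 hi a.1 (isUnit_of_mul_isUnit_right h)
  obtain ⟨c₂, hc₂⟩ := isUnit_one_sub_self_of_mem_nonunits (s * π ^ i)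
    fun h => not_isUnit_pow hπ hi (isUnit_of_mul_isUnit_right h)
  have hi := w.inv_mul
  refine bEquiv_iff.2 ⟨1, w⁻¹, 1, c₂, 0, s, ?_⟩
  simp only [genMat, Matrix.of_apply, Matrix.cons_val', Matrix.cons_val_zero,
    Matrix.cons_val_one, Matrix.cons_val_fin_one, Units.val_one, hc₂]
  refine ⟨by ring, by ring, ?_, ?_⟩
  · linear_combination (-π ^ j * a') * hi + w⁻¹.1 * (h + π ^ j * a' * hw +
      π ^ j * (π ^ m * a - π ^ i) * hsa)
  · linear_combination (-π ^ l) * hi + w⁻¹.1 * (π ^ l * hw - a * s * em)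

/-- The mirror image: a row operation `t` realises multiples of the second bracket. -/
theorem bEquiv_genMat_of_row {π : A} (hπ : Ideal.span {π} = maximalIdeal A) {i j l r : ℕ}
    (hl : 1 ≤ l) (hr : j = i + r) (hr1 : 1 ≤ r) {a a' : Aˣ} {q : A}
    (h : π ^ j * (a'.1 - a.1) = π ^ j * (q * (π ^ r * a - π ^ l))) :
    BEquiv (genMat π i j l a) (genMat π i j l a') := by
  set t : A := -(q * a'⁻¹.1) with ht
  have er : π ^ j = π ^ i * π ^ r := by rw [hr, pow_add]
  have hta : t * a' = -q := by rw [ht, neg_mul, mul_assoc, Units.inv_mul, mul_one]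
  obtain ⟨w, hw⟩ := isUnit_one_add_of_not_isUnit (x := t * (π ^ r * a - π ^ l))
    fun h => not_isUnit_pow_mul_sub_pow hπ hr1 hl a.1 (isUnit_of_mul_isUnit_right h)
  obtain ⟨b₁, hb₁⟩ := isUnit_one_sub_self_of_mem_nonunits (t * π ^ l)
    fun h => not_isUnit_pow hπ hl (isUnit_of_mul_isUnit_right h)
  have hi := w.inv_mul
  refine bEquiv_iff.2 ⟨b₁, 1, w⁻¹, 1, t, 0, ?_⟩
  simp only [genMat, Matrix.of_apply, Matrix.cons_val', Matrix.cons_val_zero,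
    Matrix.cons_val_one, Matrix.cons_val_fin_one, Units.val_one, hb₁]
  refine ⟨?_, by ring, ?_, by ring⟩
  · linear_combination (-π ^ i) * hi + w⁻¹.1 * (π ^ i * hw - a * t * er)
  · linear_combination (-π ^ j * a') * hi + w⁻¹.1 * (h + π ^ j * a' * hw +
      π ^ j * (π ^ r * a - π ^ l) * hta)

theorem min_add_le_min_add_iff {j : ℕ} {k : ℕ∞} (hj : (j : ℕ∞) ≤ k) (x y : ℕ∞) :
    min (j + x) k ≤ min (j + y) k ↔ min x (k - j) ≤ y := by
  obtain ⟨c, rfl⟩ := le_iff_exists_add.1 hj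
  rw [(ENat.addLECancellable_natCast j).add_tsub_cancel_left, min_add_add_left, min_add_add_left,
    (ENat.addLECancellable_natCast j).add_le_add_iff_left, le_min_iff]
  exact and_iff_left (min_le_right _ _)

variable [IsNoetherianRing A]

/-- After multiplication by `π ^ j`, valuations are only visible up to `len A - j`. This is the
source of that cap in the parameter rings. -/
theorem pow_mul_dvd_pow_mul_iff {π : A} (hπ : Ideal.span {π} = maximalIdeal A) {j : ℕ}
    (hj : (j : ℕ∞) ≤ len A) {d x : A} :
    (∃ p, π ^ j * x = π ^ j * (p * d)) ↔ min (v d) (len A - j) ≤ v x := by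
  rw [← min_add_le_min_add_iff hj, ← v_pow_mul hπ, ← v_pow_mul hπ, ← dvd_iff_v_le hπ]
  exact ⟨fun ⟨p, hp⟩ => ⟨p, by rw [hp]; ring⟩, fun ⟨p, hp⟩ => ⟨p, by rw [hp]; ring⟩⟩

/-- One of the two brackets divides the other, so the necessary condition collapses to a multiple of
a single bracket, which one row or one column operation realises. -/
theorem bEquiv_genMat_iff {π : A} (hπ : Ideal.span {π} = maximalIdeal A) {i j l m r : ℕ}
    (hi : 1 ≤ i) (hl : 1 ≤ l) (hr : j = i + r) (hm : j = l + m) (hr1 : 1 ≤ r) (hm1 : 1 ≤ m)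
    (hj : (j : ℕ∞) ≤ len A) {a a' : Aˣ} :
    BEquiv (genMat π i j l a) (genMat π i j l a') ↔
      min (min (v (π ^ m * a - π ^ i)) (v (π ^ r * a - π ^ l))) (len A - j) ≤
        v (a'.1 - a.1) := by
  rcases le_total (v (π ^ m * a - π ^ i)) (v (π ^ r * a - π ^ l)) with h | h
  · rw [min_eq_left h, ← pow_mul_dvd_pow_mul_iff hπ hj]
    refine ⟨fun hb => ?_, fun ⟨p, hp⟩ => bEquiv_genMat_of_col hπ hi hm hm1 hp⟩
    obtain ⟨p, q, hpq⟩ := exists_of_bEquiv_genMat hr hm hb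
    obtain ⟨c, hc⟩ := (dvd_iff_v_le hπ).2 h
    exact ⟨p + q * c, by rw [hpq, hc]; ring⟩
  · rw [min_eq_right h, ← pow_mul_dvd_pow_mul_iff hπ hj]
    refine ⟨fun hb => ?_, fun ⟨p, hp⟩ => bEquiv_genMat_of_row hπ hl hr hr1 hp⟩
    obtain ⟨p, q, hpq⟩ := exists_of_bEquiv_genMat hr hm hb
    obtain ⟨c, hc⟩ := (dvd_iff_v_le hπ).2 h
    exact ⟨q + p * c, by rw [hpq, hc]; ring⟩

theorem v_pow_mul_unit_sub_pow {π : A} (hπ : Ideal.span {π} = maximalIdeal A) {m n : ℕ}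
    (hmn : m ≠ n) (hm : (m : ℕ∞) < len A) (hn : (n : ℕ∞) < len A) (a : Aˣ) :
    v (π ^ m * a - π ^ n) = (min m n : ℕ) := by
  rcases lt_or_gt_of_ne hmn with h | h
  · have e : π ^ m * a - π ^ n = π ^ m * (a - π ^ (n - m)) := by
      rw [mul_sub, ← pow_add, Nat.add_sub_of_le h.le]
    rw [e, v_pow_mul hπ, (v_eq_zero_iff hπ).2 (isUnit_unit_sub_pow hπ (by omega) a), add_zero,
      min_eq_left hm.le, min_eq_left h.le]
  · have e : π ^ m * a - π ^ n = π ^ n * (a * (π ^ (m - n) - a⁻¹.1)) := by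
      rw [mul_sub, Units.mul_inv, mul_sub, mul_left_comm, ← pow_add, Nat.add_sub_of_le h.le]
      ring
    have hu : IsUnit (π ^ (m - n) - a⁻¹.1) := by
      rw [← neg_sub]
      exact (isUnit_unit_sub_pow hπ (by omega) a⁻¹).neg
    rw [e, v_pow_mul hπ, v_unit_mul hπ, (v_eq_zero_iff hπ).2 hu, add_zero,
      min_eq_left hn.le, min_eq_right h.le]

/-- Here `j - l ≠ i` and `j - i ≠ l`, so each bracket has the smaller of its two exponents as
valuation, whatever `a` is. -/
theorem bEquiv_genMat_iff_of_ne {π : A} (hπ : Ideal.span {π} = maximalIdeal A) {i j l : ℕ}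
    (hi : 1 ≤ i) (hij : i < j) (hl : 1 ≤ l) (hlj : l < j) (hj : (j : ℕ∞) < len A)
    (hne : i + l ≠ j) {a a' : Aˣ} :
    BEquiv (genMat π i j l a) (genMat π i j l a') ↔
      min (eps i j l : ℕ∞) (len A - j) ≤ v (a'.1 - a.1) := by
  have hlt : ∀ n : ℕ, n < j → (n : ℕ∞) < len A := fun n hn =>
    lt_trans (by exact_mod_cast hn) hj
  rw [bEquiv_genMat_iff hπ hi hl (r := j - i) (m := j - l) (by omega) (by omega) (by omega)
    (by omega) hj.le, v_pow_mul_unit_sub_pow hπ (by omega) (hlt _ (by omega)) (hlt _ hij),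
    v_pow_mul_unit_sub_pow hπ (by omega) (hlt _ (by omega)) (hlt _ hlj),
    ← (Nat.mono_cast (α := ℕ∞)).map_min]
  have : min (min (j - l) i) (min (j - i) l) = eps i j l := by
    unfold eps
    omega
  rw [this]

/-- Here `j - l = i` and `j - i = l`, so the brackets are `π ^ i * (a - 1)` and `π ^ l * (a - 1)`.
-/
theorem bEquiv_genMat_iff_of_eq {π : A} (hπ : Ideal.span {π} = maximalIdeal A) {i j l : ℕ}
    (hi : 1 ≤ i) (hl : 1 ≤ l) (hj : (j : ℕ∞) < len A)
    (heq : i + l = j) {a a' : Aˣ} :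
    BEquiv (genMat π i j l a) (genMat π i j l a') ↔
      min ((eps i j l : ℕ∞) + v (a.1 - 1)) (len A - j) ≤ v (a'.1 - a.1) := by
  have e : ∀ n : ℕ, π ^ n * a.1 - π ^ n = π ^ n * (a.1 - 1) := fun n => by ring
  have heps : eps i j l = min i l := by
    unfold eps
    omega
  rw [bEquiv_genMat_iff hπ hi hl (r := l) (m := i) (by omega) (by omega) (by omega)
    (by omega) hj.le, e, e, v_pow_mul hπ, v_pow_mul hπ, heps,
    (Nat.mono_cast (α := ℕ∞)).map_min, min_min_min_comm, min_self, min_assoc,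
    min_eq_right (tsub_le_self : len A - j ≤ len A), min_add_add_right]

end TwoByTwo

/-! ### The orbits of matrices whose only unit is the top right entry -/

section M2Parametrization

variable {A : Type*} [CommRing A] [IsLocalRing A] [IsNoetherianRing A]

theorem min_v_le_v_add {π : A} (hπ : Ideal.span {π} = maximalIdeal A) (x y p q : A) :
    min (v x) (v y) ≤ v (p * x + q * y) := by
  rcases le_total (v x) (v y) with h | h
  · rw [min_eq_left h, ← dvd_iff_v_le hπ]
    exact dvd_add (dvd_mul_left _ _) (((dvd_iff_v_le hπ).2 h).mul_left _)
  · rw [min_eq_right h, ← dvd_iff_v_le hπ]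
    exact dvd_add (((dvd_iff_v_le hπ).2 h).mul_left _) (dvd_mul_left _ _)

theorem BEquiv.v_one_zero {π : A} (hπ : Ideal.span {π} = maximalIdeal A)
    {α β : Matrix (Fin 2) (Fin 2) A} (h : BEquiv α β) : v (α 1 0) = v (β 1 0) :=
  (v_eq_iff hπ).2 h.apply_one_zero

theorem BEquiv.min_v_le {π : A} (hπ : Ideal.span {π} = maximalIdeal A)
    {α β : Matrix (Fin 2) (Fin 2) A} (h : BEquiv α β) :
    min (v (α 0 0)) (v (α 1 0)) ≤ v (β 0 0) ∧ min (v (α 1 1)) (v (α 1 0)) ≤ v (β 1 1) := by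
  obtain ⟨b₁, b₂, c₁, c₂, t, s, h1, -, -, h4⟩ := bEquiv_iff.1 h
  constructor
  · rw [h1, show (b₁ * α 0 0 + t * α 1 0) * c₁ = (b₁ * c₁ : A) * α 0 0 + (t * c₁) * α 1 0 by ring]
    exact min_v_le_v_add hπ _ _ _ _
  · rw [h4, show b₂ * α 1 0 * s + b₂ * α 1 1 * c₂ = (b₂ * c₂ : A) * α 1 1 + (b₂ * s) * α 1 0 by
      ring]
    exact min_v_le_v_add hπ _ _ _ _

/-- The diagonal valuations are not invariant, but the ideals generated by the first column and by
the last row are. -/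
theorem BEquiv.min_v_eq {π : A} (hπ : Ideal.span {π} = maximalIdeal A)
    {α β : Matrix (Fin 2) (Fin 2) A} (h : BEquiv α β) :
    min (v (α 0 0)) (v (α 1 0)) = min (v (β 0 0)) (v (β 1 0)) ∧
      min (v (α 1 1)) (v (α 1 0)) = min (v (β 1 1)) (v (β 1 0)) := by
  have h0 := h.v_one_zero hπ
  have h1 := h.min_v_le hπ
  have h2 := h.symm.min_v_le hπ
  exact ⟨le_antisymm (le_min h1.1 ((min_le_right _ _).trans h0.le))
      (le_min h2.1 ((min_le_right _ _).trans h0.ge)),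
    le_antisymm (le_min h1.2 ((min_le_right _ _).trans h0.le))
      (le_min h2.2 ((min_le_right _ _).trans h0.ge))⟩

omit [IsLocalRing A] [IsNoetherianRing A] in
theorem orbitOf_eq_iff {α β : M2 A} : orbitOf α = orbitOf β ↔ BEquiv α.1 β.1 := Quotient.eq

/-- If `j = k`, capping at `j` changes nothing. If `j < k`, a diagonal entry is either below `j` or
equal to `k`, so its capped value recovers it. -/
theorem discreteSet_ext {k : ℕ∞} {t t' : Matrix (Fin 2) (Fin 2) ℕ∞} (ht : t ∈ discreteSet k)
    (ht' : t' ∈ discreteSet k) (h : t 1 0 = t' 1 0)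
    (h0 : min (t 0 0) (t 1 0) = min (t' 0 0) (t' 1 0))
    (h1 : min (t 1 1) (t 1 0) = min (t' 1 1) (t' 1 0)) : t = t' := by
  obtain ⟨i, j, l, rfl, ht⟩ := ht
  obtain ⟨i', j', l', rfl, ht'⟩ := ht'
  simp only [Matrix.of_apply, Matrix.cons_val', Matrix.cons_val_zero,
    Matrix.cons_val_one, Matrix.cons_val_fin_one] at h h0 h1
  subst h
  have hi : i = i' := by grind
  have hl : l = l' := by grind
  rw [hi, hl]

theorem not_mem_discreteSet {k : ℕ∞} {t : Matrix (Fin 2) (Fin 2) ℕ∞}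
    (h : t 1 0 < k) (h0 : min (t 0 0) (t 1 0) < t 1 0) (h1 : min (t 1 1) (t 1 0) < t 1 0) :
    t ∉ discreteSet k := by
  rintro ⟨i, j, l, rfl, ht⟩
  simp only [Matrix.of_apply, Matrix.cons_val', Matrix.cons_val_zero,
    Matrix.cons_val_one, Matrix.cons_val_fin_one] at h h0 h1
  grind

omit [IsNoetherianRing A] in
theorem exists_v_eq {π : A} (hπ : Ideal.span {π} = maximalIdeal A) {n : ℕ∞} (hn : n ≤ len A) :
    ∃ x : A, v x = n := by
  rcases eq_or_ne n ⊤ with rfl | hne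
  · exact ⟨0, by rw [v_zero]; exact top_le_iff.1 hn⟩
  · lift n to ℕ using hne
    exact ⟨π ^ n, by rw [v_pow hπ, min_eq_left hn]⟩

theorem exists_map_v_eq {π : A} (hπ : Ideal.span {π} = maximalIdeal A)
    {t : Matrix (Fin 2) (Fin 2) ℕ∞} (ht : t ∈ discreteSet (len A)) :
    ∃ α : M2 A, α.1.map v = t := by
  obtain ⟨i, j, l, rfl, ht⟩ := ht
  have hk : 1 ≤ len A := Order.one_le_iff_pos.2 len_pos
  have h : (1 ≤ i ∧ i ≤ len A) ∧ (1 ≤ j ∧ j ≤ len A) ∧ (1 ≤ l ∧ l ≤ len A) := by grind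
  obtain ⟨⟨i1, ik⟩, ⟨j1, jk⟩, ⟨l1, lk⟩⟩ := h
  obtain ⟨x, rfl⟩ := exists_v_eq hπ ik
  obtain ⟨y, rfl⟩ := exists_v_eq hπ jk
  obtain ⟨z, rfl⟩ := exists_v_eq hπ lk
  refine ⟨⟨!![x, 1; y, z], isUnit_one, (one_le_v_iff hπ).1 i1, (one_le_v_iff hπ).1 j1,
    (one_le_v_iff hπ).1 l1⟩, ?_⟩
  have h1 : v (1 : A) = 0 := (v_eq_zero_iff hπ).2 isUnit_one
  ext r s
  fin_cases r <;> fin_cases s <;> simp [h1]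

theorem exists_eq_zero_of_mem_discreteSet {π : A} (hπ : Ideal.span {π} = maximalIdeal A)
    {α : Matrix (Fin 2) (Fin 2) A} (h : α.map v ∈ discreteSet (len A)) :
    ∃ i j, α i j = 0 := by
  obtain ⟨i, j, l, ht, h⟩ := h
  have h0 : v (α 0 0) = i := congr_fun (congr_fun ht 0) 0
  have h1 : v (α 1 0) = j := congr_fun (congr_fun ht 1) 0
  have h2 : v (α 1 1) = l := congr_fun (congr_fun ht 1) 1
  simp only [← v_eq_len_iff hπ, Fin.exists_fin_two, h0, h1, h2]
  tauto

/-- Diagonal scaling multiplies the entries by units `b_r c_s`, which satisfy one multiplicative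
relation. A zero entry leaves its own factor free, so the other three can be prescribed. -/
theorem bEquiv_of_v_eq {π : A} (hπ : Ideal.span {π} = maximalIdeal A)
    {α β : Matrix (Fin 2) (Fin 2) A} (h : ∀ i j, v (α i j) = v (β i j))
    (h0 : ∃ i j, α i j = 0) : BEquiv α β := by
  obtain ⟨p, hp⟩ := (v_eq_iff hπ).1 (h 0 0)
  obtain ⟨q, hq⟩ := (v_eq_iff hπ).1 (h 1 0)
  obtain ⟨r, hr⟩ := (v_eq_iff hπ).1 (h 1 1)
  obtain ⟨u, hu⟩ := (v_eq_iff hπ).1 (h 0 1)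
  have er := r.inv_mul
  have eu := u.inv_mul
  have ep := p.inv_mul
  have eq := q.inv_mul
  rw [bEquiv_iff, hp, hq, hr, hu]
  simp only [Fin.exists_fin_two] at h0
  obtain (h0 | h0) | (h0 | h0) := h0
  · refine ⟨1, r * u⁻¹, q * u * r⁻¹, u, 0, 0, ?_⟩
    simp only [h0, Units.val_mul, Units.val_one]
    refine ⟨by ring, by ring, ?_, ?_⟩
    · linear_combination (-q * α 1 0) * er - q * α 1 0 * r⁻¹.1 * r * eu
    · linear_combination (-r * α 1 1) * eu
  · refine ⟨1, q * p⁻¹, p, r * p * q⁻¹, 0, 0, ?_⟩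
    simp only [h0, Units.val_mul, Units.val_one]
    refine ⟨by ring, by ring, ?_, ?_⟩
    · linear_combination (-q * α 1 0) * ep
    · linear_combination (-r * α 1 1) * eq - r * α 1 1 * q⁻¹.1 * q * ep
  · refine ⟨1, r * u⁻¹, p, u, 0, 0, ?_⟩
    simp only [h0, Units.val_mul, Units.val_one]
    refine ⟨by ring, by ring, by ring, ?_⟩
    linear_combination (-r * α 1 1) * eu
  · refine ⟨1, q * p⁻¹, p, u, 0, 0, ?_⟩
    simp only [h0, Units.val_mul, Units.val_one]
    refine ⟨by ring, by ring, ?_, by ring⟩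
    linear_combination (-q * α 1 0) * ep

omit [IsNoetherianRing A] in
theorem genMat_mem_M2 {π : A} (hπ : Ideal.span {π} = maximalIdeal A) {i j l : ℕ} (hi : 1 ≤ i)
    (hij : i < j) (hl : 1 ≤ l) (a : Aˣ) : genMat π i j l a ∈ M2 A :=
  ⟨isUnit_one, not_isUnit_pow hπ hi, fun h => not_isUnit_pow hπ (by omega)
    (isUnit_of_mul_isUnit_left (y := a.1) h), not_isUnit_pow hπ hl⟩

theorem v_genMat {π : A} (hπ : Ideal.span {π} = maximalIdeal A) {i j l : ℕ}
    (hij : i < j) (hlj : l < j) (hj : (j : ℕ∞) < len A) (a : Aˣ) :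
    v (genMat π i j l a 0 0) = i ∧ v (genMat π i j l a 1 0) = j ∧
      v (genMat π i j l a 1 1) = l := by
  have hlt : ∀ n : ℕ, n ≤ j → (n : ℕ∞) ≤ len A := fun n hn =>
    le_trans (by exact_mod_cast hn) hj.le
  refine ⟨?_, ?_, ?_⟩
  · exact (v_pow hπ i).trans (min_eq_left (hlt _ hij.le))
  · change v (π ^ j * a.1) = j
    rw [mul_comm, v_unit_mul hπ, v_pow hπ, min_eq_left hj.le]
  · exact (v_pow hπ l).trans (min_eq_left (hlt _ hlj.le))

theorem index_eq_of_bEquiv_genMat {π : A} (hπ : Ideal.span {π} = maximalIdeal A)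
    {i j l i' j' l' : ℕ} (hij : i < j) (hlj : l < j) (hj : (j : ℕ∞) < len A)
    (hij' : i' < j') (hlj' : l' < j') (hj' : (j' : ℕ∞) < len A) {a a' : Aˣ}
    (h : BEquiv (genMat π i j l a) (genMat π i' j' l' a')) : i = i' ∧ j = j' ∧ l = l' := by
  obtain ⟨h1, h2, h3⟩ := v_genMat hπ hij hlj hj a
  obtain ⟨h1', h2', h3'⟩ := v_genMat hπ hij' hlj' hj' a'
  have e1 := h.v_one_zero hπ
  have e2 := h.min_v_eq hπ
  rw [h1, h2, h3, h1', h2', h3', min_eq_left (by exact_mod_cast hij.le),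
    min_eq_left (by exact_mod_cast hij'.le), min_eq_left (by exact_mod_cast hlj.le),
    min_eq_left (by exact_mod_cast hlj'.le)] at e2
  rw [h2, h2'] at e1
  exact ⟨by exact_mod_cast e2.1, by exact_mod_cast e1, by exact_mod_cast e2.2⟩

theorem not_bEquiv_genMat_of_mem_discreteSet {π : A} (hπ : Ideal.span {π} = maximalIdeal A)
    {i j l : ℕ} (hij : i < j) (hlj : l < j) (hj : (j : ℕ∞) < len A) {a : Aˣ}
    {β : Matrix (Fin 2) (Fin 2) A} (hβ : β.map v ∈ discreteSet (len A)) :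
    ¬ BEquiv (genMat π i j l a) β := by
  intro h
  obtain ⟨h1, h2, h3⟩ := v_genMat hπ hij hlj hj a
  have e1 := h.v_one_zero hπ
  have e2 := h.min_v_eq hπ
  have hi : (i : ℕ∞) < j := by exact_mod_cast hij
  have hl : (l : ℕ∞) < j := by exact_mod_cast hlj
  rw [h2] at e1
  rw [h1, h2, h3, min_eq_left hi.le, min_eq_left hl.le] at e2
  refine not_mem_discreteSet ?_ ?_ ?_ hβ
  · simpa [← e1] using hj
  · simp only [Matrix.map_apply]
    rw [← e2.1, ← e1]
    exact hi
  · simp only [Matrix.map_apply]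
    rw [← e2.2, ← e1]
    exact hl

theorem bEquiv_iff_of_mem_discreteSet {π : A} (hπ : Ideal.span {π} = maximalIdeal A)
    {α β : Matrix (Fin 2) (Fin 2) A} (hα : α.map v ∈ discreteSet (len A))
    (hβ : β.map v ∈ discreteSet (len A)) : BEquiv α β ↔ α.map v = β.map v := by
  constructor
  · intro h
    exact discreteSet_ext hα hβ (h.v_one_zero hπ) (h.min_v_eq hπ).1 (h.min_v_eq hπ).2
  · intro h
    exact bEquiv_of_v_eq hπ (fun i j => congr_fun (congr_fun h i) j)
      (exists_eq_zero_of_mem_discreteSet hπ hα)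

/-- The orbit parametrised by a point of `M2Param A`, with respect to the uniformizer `π`. -/
noncomputable def m2Orbit {π : A} (hπ : Ideal.span {π} = maximalIdeal A) : M2Param A → M2Orbits A
  -- The lift of `a` to a unit of `A` is arbitrary; by `bEquiv_genMat_iff_unitMod_of_ne` and
  -- `bEquiv_genMat_iff_unitMod_of_eq` its choice does not affect the orbit.
  | .generic i j l hi hij hl _ _ _ a =>
      orbitOf ⟨genMat π i j l (Function.invFun (unitMod _) a), genMat_mem_M2 hπ hi hij hl _⟩
  | .special i j l hi hij hl _ _ _ _ _ a =>
      orbitOf ⟨genMat π i j l (Function.invFun (unitMod _) a.1), genMat_mem_M2 hπ hi hij hl _⟩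
  | .discrete t => orbitOf (exists_map_v_eq hπ t.2).choose

theorem unitMod_invFun {π : A} (hπ : Ideal.span {π} = maximalIdeal A) {m : ℕ∞}
    (hm : m ≤ len A) (h1 : 1 ≤ m) (a : (Trunc A m)ˣ) :
    unitMod m (Function.invFun (unitMod m) a) = a :=
  Function.invFun_eq (unitMod_surjective hπ hm h1 a)

omit [IsNoetherianRing A] in
theorem min_sub_le_len (x : ℕ∞) (j : ℕ) : min x (len A - j) ≤ len A :=
  (min_le_right _ _).trans tsub_le_self

theorem one_le_eps {i j l : ℕ} (hi : 1 ≤ i) (hij : i < j) (hl : 1 ≤ l) (hlj : l < j) :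
    1 ≤ eps i j l := by
  unfold eps
  omega

theorem one_le_min_eps_add {k : ℕ∞} {i j l : ℕ} (hi : 1 ≤ i) (hij : i < j) (hl : 1 ≤ l)
    (hlj : l < j) (hj : (j : ℕ∞) < k) (δ : ℕ∞) : 1 ≤ min ((eps i j l : ℕ∞) + δ) (k - j) := by
  refine le_min (le_add_right ?_) (Order.one_le_iff_pos.2 (tsub_pos_of_lt hj))
  exact_mod_cast one_le_eps hi hij hl hlj

/-- With `x = ε ≥ 1` a finite `δ` is strictly below `ε + δ`, so truncating there does not blur
whether `v (a - 1)`, capped at `c`, equals `δ`. -/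
theorem min_min_add_eq_iff {x y δ c : ℕ∞} (hx : 1 ≤ x) (hδ : δ ≤ c) :
    min y (min (x + δ) c) = δ ↔ min y c = δ := by
  rw [min_left_comm]
  constructor
  · intro h
    rcases eq_or_ne δ ⊤ with rfl | hne
    · rwa [add_top, min_top_left] at h
    have hlt : δ < x + δ := by
      refine (ENat.add_one_le_iff hne).1 ?_
      rw [add_comm]
      exact add_le_add_left hx δ
    rcases min_choice (x + δ) (min y c) with e | e
    · exact absurd (h.symm.trans e) hlt.ne
    · exact e.symm.trans h
  · intro h
    rw [h, min_eq_right le_add_self]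

theorem min_add_min (x y c : ℕ∞) : min (x + min y c) c = min (x + y) c := by
  rw [← min_add_add_left, min_assoc, min_eq_right (le_add_self : c ≤ x + c)]

theorem unitMod_mem_unitsDelta_eps_iff {π : A} (hπ : Ideal.span {π} = maximalIdeal A)
    {i j l : ℕ} (hi : 1 ≤ i) (hij : i < j) (hl : 1 ≤ l) (hlj : l < j)
    {δ : ℕ∞} (hδ : δ ≤ len A - j) (a : Aˣ) :
    unitMod (min ((eps i j l : ℕ∞) + δ) (len A - j)) a ∈ unitsDelta A _ δ ↔
      min (v (a.1 - 1)) (len A - j) = δ := by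
  rw [unitMod_mem_unitsDelta_iff hπ (min_sub_le_len _ _),
    min_min_add_eq_iff (by exact_mod_cast one_le_eps hi hij hl hlj) hδ]

theorem bEquiv_genMat_iff_unitMod_of_ne {π : A} (hπ : Ideal.span {π} = maximalIdeal A)
    {i j l : ℕ} (hi : 1 ≤ i) (hij : i < j) (hl : 1 ≤ l) (hlj : l < j) (hj : (j : ℕ∞) < len A)
    (hne : i + l ≠ j) {a a' : Aˣ} :
    BEquiv (genMat π i j l a) (genMat π i j l a') ↔
      unitMod (min (eps i j l : ℕ∞) (len A - j)) a =
        unitMod (min (eps i j l : ℕ∞) (len A - j)) a' := by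
  rw [bEquiv_genMat_iff_of_ne hπ hi hij hl hlj hj hne, unitMod_eq_iff hπ (min_sub_le_len _ _)]

theorem bEquiv_genMat_iff_unitMod_of_eq {π : A} (hπ : Ideal.span {π} = maximalIdeal A)
    {i j l : ℕ} (hi : 1 ≤ i) (hij : i < j) (hl : 1 ≤ l) (hlj : l < j) (hj : (j : ℕ∞) < len A)
    (heq : i + l = j) {δ : ℕ∞} (hδ : δ ≤ len A - j) {a a' : Aˣ}
    (ha : unitMod (min ((eps i j l : ℕ∞) + δ) (len A - j)) a ∈ unitsDelta A _ δ) :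
    BEquiv (genMat π i j l a) (genMat π i j l a') ↔
      unitMod (min ((eps i j l : ℕ∞) + δ) (len A - j)) a =
        unitMod (min ((eps i j l : ℕ∞) + δ) (len A - j)) a' := by
  rw [unitMod_mem_unitsDelta_eps_iff hπ hi hij hl hlj hδ] at ha
  rw [bEquiv_genMat_iff_of_eq hπ hi hl hj heq, unitMod_eq_iff hπ (min_sub_le_len _ _), ← ha,
    min_add_min]

/-- Equivalence forces `v (a' - a) ≥ min (ε + δ) (k - j) ≥ δ`, and the ultrametric inequality
carries `v (a - 1) ≥ δ` over to `a'`. Applied in both directions this makes `δ` an invariant. -/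
theorem delta_le_of_bEquiv_genMat {π : A} (hπ : Ideal.span {π} = maximalIdeal A)
    {i j l : ℕ} (hi : 1 ≤ i) (hij : i < j) (hl : 1 ≤ l) (hlj : l < j) (hj : (j : ℕ∞) < len A)
    (heq : i + l = j) {δ δ' : ℕ∞} (hδ : δ ≤ len A - j) (hδ' : δ' ≤ len A - j) {a a' : Aˣ}
    (ha : unitMod (min ((eps i j l : ℕ∞) + δ) (len A - j)) a ∈ unitsDelta A _ δ)
    (ha' : unitMod (min ((eps i j l : ℕ∞) + δ') (len A - j)) a' ∈ unitsDelta A _ δ')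
    (h : BEquiv (genMat π i j l a) (genMat π i j l a')) : δ ≤ δ' := by
  rw [unitMod_mem_unitsDelta_eps_iff hπ hi hij hl hlj hδ] at ha
  rw [unitMod_mem_unitsDelta_eps_iff hπ hi hij hl hlj hδ'] at ha'
  rw [bEquiv_genMat_iff_of_eq hπ hi hl hj heq, ← min_add_min, ha] at h
  have h1 : δ ≤ v (a.1 - 1) := ha ▸ min_le_left _ _
  have h2 : δ ≤ v (a'.1 - a.1) := (le_min le_add_self hδ).trans h
  have := min_v_le_v_add hπ (a'.1 - a.1) (a.1 - 1) 1 1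
  rw [one_mul, one_mul, sub_add_sub_cancel] at this
  exact ha' ▸ le_min ((le_min h2 h1).trans this) hδ

theorem m2Orbit_generic {π : A} (hπ : Ideal.span {π} = maximalIdeal A) {i j l : ℕ} (hi : 1 ≤ i)
    (hij : i < j) (hl : 1 ≤ l) (hlj : l < j) (hj : (j : ℕ∞) < len A) (hne : i + l ≠ j) (a : Aˣ)
    (α : M2 A) (hα : α.1 = genMat π i j l a) :
    m2Orbit hπ (.generic i j l hi hij hl hlj hj hne (unitMod _ a)) = orbitOf α := by
  refine orbitOf_eq_iff.2 ?_
  rw [hα]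
  refine (bEquiv_genMat_iff_unitMod_of_ne hπ hi hij hl hlj hj hne).2
    (unitMod_invFun hπ (min_sub_le_len _ _) ?_ _)
  simpa using one_le_min_eps_add hi hij hl hlj hj 0

theorem m2Orbit_special {π : A} (hπ : Ideal.span {π} = maximalIdeal A) {i j l : ℕ} (hi : 1 ≤ i)
    (hij : i < j) (hl : 1 ≤ l) (hlj : l < j) (hj : (j : ℕ∞) < len A) (heq : i + l = j)
    {δ : ℕ∞} (hδ : δ ≤ len A - j) (a : Aˣ)
    (ha : unitMod (min ((eps i j l : ℕ∞) + δ) (len A - j)) a ∈ unitsDelta A _ δ)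
    (α : M2 A) (hα : α.1 = genMat π i j l a) :
    m2Orbit hπ (.special i j l hi hij hl hlj hj heq δ hδ ⟨unitMod _ a, ha⟩) = orbitOf α := by
  refine orbitOf_eq_iff.2 ?_
  rw [hα]
  exact ((bEquiv_genMat_iff_unitMod_of_eq hπ hi hij hl hlj hj heq hδ ha).2
    (unitMod_invFun hπ (min_sub_le_len _ _) (one_le_min_eps_add hi hij hl hlj hj δ) _).symm).symm

theorem m2Orbit_discrete {π : A} (hπ : Ideal.span {π} = maximalIdeal A) (α : M2 A)
    (h : α.1.map v ∈ discreteSet (len A)) : m2Orbit hπ (.discrete ⟨α.1.map v, h⟩) = orbitOf α := by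
  have hc := (exists_map_v_eq hπ h).choose_spec
  exact orbitOf_eq_iff.2 ((bEquiv_iff_of_mem_discreteSet hπ (hc.symm ▸ h) h).2 hc)

theorem m2Orbit_injective {π : A} (hπ : Ideal.span {π} = maximalIdeal A) :
    Function.Injective (m2Orbit hπ) := by
  intro p q h
  rcases p with ⟨i, j, l, hi, hij, hl, hlj, hj, hne, a⟩ |
    ⟨i, j, l, hi, hij, hl, hlj, hj, heq, δ, hδ, a⟩ | t <;>
  rcases q with ⟨i', j', l', hi', hij', hl', hlj', hj', hne', a'⟩ |
    ⟨i', j', l', hi', hij', hl', hlj', hj', heq', δ', hδ', a'⟩ | t'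
  · replace h := orbitOf_eq_iff.1 h
    obtain ⟨rfl, rfl, rfl⟩ := index_eq_of_bEquiv_genMat hπ hij hlj hj hij' hlj' hj' h
    have h1 := one_le_min_eps_add hi hij hl hlj hj 0
    rw [add_zero] at h1
    have := (bEquiv_genMat_iff_unitMod_of_ne hπ hi hij hl hlj hj hne).1 h
    rw [unitMod_invFun hπ (min_sub_le_len _ _) h1,
      unitMod_invFun hπ (min_sub_le_len _ _) h1] at this
    rw [this]
  · replace h := orbitOf_eq_iff.1 h
    obtain ⟨rfl, rfl, rfl⟩ := index_eq_of_bEquiv_genMat hπ hij hlj hj hij' hlj' hj' h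
    exact absurd heq' hne
  · replace h := orbitOf_eq_iff.1 h
    exact absurd h (not_bEquiv_genMat_of_mem_discreteSet hπ hij hlj hj
      ((exists_map_v_eq hπ t'.2).choose_spec.symm ▸ t'.2))
  · replace h := orbitOf_eq_iff.1 h
    obtain ⟨rfl, rfl, rfl⟩ := index_eq_of_bEquiv_genMat hπ hij hlj hj hij' hlj' hj' h
    exact absurd heq hne'
  · replace h := orbitOf_eq_iff.1 h
    obtain ⟨rfl, rfl, rfl⟩ := index_eq_of_bEquiv_genMat hπ hij hlj hj hij' hlj' hj' h
    have ha := unitMod_invFun hπ (min_sub_le_len _ _) (one_le_min_eps_add hi hij hl hlj hj δ) a.1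
    have ha' := unitMod_invFun hπ (min_sub_le_len _ _)
      (one_le_min_eps_add hi hij hl hlj hj δ') a'.1
    have hm := ha.symm ▸ a.2
    have hm' := ha'.symm ▸ a'.2
    -- The two residues live in quotients depending on `δ`, so they can be compared only after `δ`
    -- is identified.
    obtain rfl : δ = δ' := le_antisymm
      (delta_le_of_bEquiv_genMat hπ hi hij hl hlj hj heq hδ hδ' hm hm' h)
      (delta_le_of_bEquiv_genMat hπ hi hij hl hlj hj heq hδ' hδ hm' hm h.symm)
    have := (bEquiv_genMat_iff_unitMod_of_eq hπ hi hij hl hlj hj heq hδ hm).1 h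
    rw [ha, ha'] at this
    rw [Subtype.ext this]
  · replace h := orbitOf_eq_iff.1 h
    exact absurd h (not_bEquiv_genMat_of_mem_discreteSet hπ hij hlj hj
      ((exists_map_v_eq hπ t'.2).choose_spec.symm ▸ t'.2))
  · replace h := orbitOf_eq_iff.1 h
    exact absurd h.symm (not_bEquiv_genMat_of_mem_discreteSet hπ hij' hlj' hj'
      ((exists_map_v_eq hπ t.2).choose_spec.symm ▸ t.2))
  · replace h := orbitOf_eq_iff.1 h
    exact absurd h.symm (not_bEquiv_genMat_of_mem_discreteSet hπ hij' hlj' hj'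
      ((exists_map_v_eq hπ t.2).choose_spec.symm ▸ t.2))
  · replace h := orbitOf_eq_iff.1 h
    have hc := (exists_map_v_eq hπ t.2).choose_spec
    have hc' := (exists_map_v_eq hπ t'.2).choose_spec
    have := (bEquiv_iff_of_mem_discreteSet hπ (hc.symm ▸ t.2) (hc'.symm ▸ t'.2)).1 h
    rw [Subtype.ext (hc.symm.trans (this.trans hc'))]

theorem map_v_eq {π : A} (hπ : Ideal.span {π} = maximalIdeal A) {α : Matrix (Fin 2) (Fin 2) A}
    (h : IsUnit (α 0 1)) : α.map v = !![v (α 0 0), 0; v (α 1 0), v (α 1 1)] := by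
  ext i j
  fin_cases i <;> fin_cases j <;> simp [(v_eq_zero_iff hπ).2 h]

theorem exists_m2Orbit_of_bEquiv {π : A} (hπ : Ideal.span {π} = maximalIdeal A) {α β : M2 A}
    (h : BEquiv α.1 β.1) (hβ : β.1.map v ∈ discreteSet (len A)) :
    ∃ p, m2Orbit hπ p = orbitOf α :=
  ⟨_, (m2Orbit_discrete hπ β hβ).trans (orbitOf_eq_iff.2 h.symm)⟩

omit [IsNoetherianRing A] in
theorem isUnit_sub_mul {α : M2 A} (c : A) (i : Fin 2) :
    IsUnit (α.1 0 1 - c * α.1 i i) := by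
  have hi : ¬ IsUnit (α.1 i i) := by
    fin_cases i
    exacts [α.2.2.1, α.2.2.2.2]
  by_contra h
  have h1 : α.1 0 1 - c * α.1 i i ∈ maximalIdeal A := h
  have h2 : α.1 i i ∈ maximalIdeal A := hi
  have h3 : α.1 0 1 ∈ maximalIdeal A := by
    simpa using Ideal.add_mem _ h1 (Ideal.mul_mem_left _ c h2)
  exact h3 α.2.1

-- A row operation clears the top left entry. The top right entry changes by a multiple of a nonunit
-- and stays a unit; the bottom row is untouched.
omit [IsNoetherianRing A] in
theorem exists_bEquiv_apply_zero_zero {α : M2 A} (h : α.1 1 0 ∣ α.1 0 0) :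
    ∃ β : M2 A, BEquiv α.1 β.1 ∧ β.1 0 0 = 0 ∧ β.1 1 0 = α.1 1 0 ∧ β.1 1 1 = α.1 1 1 := by
  obtain ⟨c, hc⟩ := h
  refine ⟨⟨!![0, α.1 0 1 - c * α.1 1 1; α.1 1 0, α.1 1 1], isUnit_sub_mul c 1, not_isUnit_zero,
    α.2.2.2.1, α.2.2.2.2⟩, bEquiv_iff.2 ⟨1, 1, 1, 1, -c, 0, ?_⟩, rfl, rfl, rfl⟩
  simp [hc, mul_comm c, sub_eq_add_neg]

omit [IsNoetherianRing A] in
theorem exists_bEquiv_apply_one_one {α : M2 A} (h : α.1 1 0 ∣ α.1 1 1) :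
    ∃ β : M2 A, BEquiv α.1 β.1 ∧ β.1 1 1 = 0 ∧ β.1 1 0 = α.1 1 0 ∧ β.1 0 0 = α.1 0 0 := by
  obtain ⟨c, hc⟩ := h
  refine ⟨⟨!![α.1 0 0, α.1 0 1 - c * α.1 0 0; α.1 1 0, 0], isUnit_sub_mul c 0, α.2.2.1,
    α.2.2.2.1, not_isUnit_zero⟩, bEquiv_iff.2 ⟨1, 1, 1, 1, 0, -c, ?_⟩, rfl, rfl, rfl⟩
  simp [hc, mul_comm c]
  ring

-- Diagonal scaling can normalise three of the four unit factors. The cross ratio `u q / (p r)` is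
-- what remains.
omit [IsLocalRing A] [IsNoetherianRing A] in
theorem exists_bEquiv_genMat {π : A} {i j l : ℕ} {α : Matrix (Fin 2) (Fin 2) A}
    (h : IsUnit (α 0 1)) {p q r : Aˣ} (hp : α 0 0 = p * π ^ i) (hq : α 1 0 = q * π ^ j)
    (hr : α 1 1 = r * π ^ l) : ∃ a, BEquiv α (genMat π i j l a) := by
  obtain ⟨u, hu⟩ := h
  have ep := p.inv_mul
  have er := r.inv_mul
  have eu := u.inv_mul
  refine ⟨u * p⁻¹ * r⁻¹ * q, bEquiv_iff.2 ⟨p⁻¹, u * p⁻¹ * r⁻¹, 1, p * u⁻¹, 0, 0, ?_⟩⟩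
  simp only [genMat, Matrix.of_apply, Matrix.cons_val', Matrix.cons_val_zero,
    Matrix.cons_val_one, Matrix.cons_val_fin_one, hp, hq, hr, ← hu, Units.val_mul, Units.val_one]
  refine ⟨?_, ?_, by ring, ?_⟩
  · linear_combination (-π ^ i) * ep
  · linear_combination -ep - p⁻¹.1 * p * eu
  · linear_combination (-π ^ l) * er - r⁻¹.1 * r * π ^ l * (ep + p⁻¹.1 * p * eu)

theorem m2Orbit_surjective {π : A} (hπ : Ideal.span {π} = maximalIdeal A) :
    Function.Surjective (m2Orbit hπ) := by
  intro o
  obtain ⟨α, rfl⟩ := Quotient.exists_rep o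
  change ∃ p, m2Orbit hπ p = orbitOf α
  have i1 := (one_le_v_iff hπ).2 α.2.2.1
  have j1 := (one_le_v_iff hπ).2 α.2.2.2.1
  have l1 := (one_le_v_iff hπ).2 α.2.2.2.2
  rcases eq_or_ne (v (α.1 1 0)) (len A) with hy | hy
  -- With lower left entry 0 the valuation matrix lies in the discrete set as it stands.
  · refine exists_m2Orbit_of_bEquiv hπ (BEquiv.refl _) ?_
    rw [map_v_eq hπ α.2.1]
    exact ⟨_, _, _, rfl, Or.inl ⟨hy, i1, v_le_len hπ _, l1, v_le_len hπ _⟩⟩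
  have hj : v (α.1 1 0) < len A := lt_of_le_of_ne (v_le_len hπ _) hy
  rcases le_or_gt (v (α.1 1 0)) (v (α.1 0 0)) with hij | hij
  · obtain ⟨β, hβ, hβ0, hβ1, hβ2⟩ := exists_bEquiv_apply_zero_zero ((dvd_iff_v_le hπ).2 hij)
    have k0 : v (β.1 0 0) = len A := by rw [hβ0, v_zero]
    rcases le_or_gt (v (α.1 1 0)) (v (α.1 1 1)) with hlj | hlj
    · rw [← hβ1, ← hβ2] at hlj
      obtain ⟨γ, hγ, hγ0, hγ1, hγ2⟩ := exists_bEquiv_apply_one_one ((dvd_iff_v_le hπ).2 hlj)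
      refine exists_m2Orbit_of_bEquiv hπ (hβ.trans hγ) ?_
      rw [map_v_eq hπ γ.2.1, hγ1, hγ2, hβ1, hγ0, v_zero]
      exact ⟨_, _, _, rfl, Or.inr (Or.inr (Or.inr ⟨j1, hj, k0, rfl⟩))⟩
    · refine exists_m2Orbit_of_bEquiv hπ hβ ?_
      rw [map_v_eq hπ β.2.1, hβ1, hβ2]
      exact ⟨_, _, _, rfl, Or.inr (Or.inr (Or.inl ⟨l1, hlj, hj, k0⟩))⟩
  rcases le_or_gt (v (α.1 1 0)) (v (α.1 1 1)) with hlj | hlj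
  · obtain ⟨β, hβ, hβ0, hβ1, hβ2⟩ := exists_bEquiv_apply_one_one ((dvd_iff_v_le hπ).2 hlj)
    refine exists_m2Orbit_of_bEquiv hπ hβ ?_
    rw [map_v_eq hπ β.2.1, hβ0, hβ1, hβ2, v_zero]
    exact ⟨_, _, _, rfl, Or.inr (Or.inl ⟨i1, hij, hj, rfl⟩)⟩
  -- What remains is `i, l < j < k`, where no entry is zero and none can be cleared.
  have ne : ∀ {x : A}, v x < len A → x ≠ 0 := fun hx h0 => hx.ne (h0 ▸ v_zero)
  obtain ⟨p, i, hp, hi⟩ := exists_eq_unit_mul_pow hπ (ne (hij.trans hj))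
  obtain ⟨r, l, hr, hl⟩ := exists_eq_unit_mul_pow hπ (ne (hlj.trans hj))
  obtain ⟨q, j, hq, hj⟩ := exists_eq_unit_mul_pow hπ (ne hj)
  obtain ⟨a, ha⟩ := exists_bEquiv_genMat α.2.1 hp hq hr
  rw [hp, hq, v_unit_mul_pow hπ, v_unit_mul_pow hπ, min_eq_left hi.le, min_eq_left hj.le] at hij
  rw [hr, hq, v_unit_mul_pow hπ, v_unit_mul_pow hπ, min_eq_left hl.le, min_eq_left hj.le] at hlj
  rw [hp, v_unit_mul_pow hπ, min_eq_left hi.le] at i1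
  rw [hr, v_unit_mul_pow hπ, min_eq_left hl.le] at l1
  norm_cast at hij hlj i1 l1
  have e : orbitOf ⟨genMat π i j l a, genMat_mem_M2 hπ i1 hij l1 a⟩ = orbitOf α :=
    orbitOf_eq_iff.2 ha.symm
  by_cases hne : i + l = j
  · have hδ : min (v (a.1 - 1)) (len A - j) ≤ len A - j := min_le_right _ _
    refine ⟨.special i j l i1 hij l1 hlj hj hne _ hδ ⟨unitMod _ a, ?_⟩,
      (m2Orbit_special hπ i1 hij l1 hlj hj hne hδ a _ _ rfl).trans e⟩
    exact (unitMod_mem_unitsDelta_eps_iff hπ i1 hij l1 hlj hδ a).2 rfl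
  · exact ⟨_, (m2Orbit_generic hπ i1 hij l1 hlj hj hne a _ rfl).trans e⟩

end M2Parametrization

/-! ### The element of S₃ attached to a block, and the fibres over it -/

section RelativePosition

variable {A : Type*} [CommRing A]

open Classical in
/-- The element of `S_3` attached to a matrix with lower left part `α`. -/
noncomputable def relPos (α : Matrix (Fin 2) (Fin 2) A) : Equiv.Perm (Fin 3) :=
  if IsUnit (α 1 0) then (if IsUnit α.det then s1 * s2 * s1 else s2 * s1)
  else if IsUnit (α 0 0) then (if IsUnit (α 1 1) then s1 * s2 else s1)
  else if IsUnit (α 1 1) then s2 else 1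

theorem relPos_eq_one_iff {α : Matrix (Fin 2) (Fin 2) A} :
    relPos α = 1 ↔ ¬ IsUnit (α 1 0) ∧ ¬ IsUnit (α 0 0) ∧ ¬ IsUnit (α 1 1) := by
  unfold relPos
  split_ifs <;> constructor <;> intro h <;> first | exact absurd h (by decide) | tauto

theorem relPos_eq_s1_iff {α : Matrix (Fin 2) (Fin 2) A} :
    relPos α = s1 ↔ ¬ IsUnit (α 1 0) ∧ IsUnit (α 0 0) ∧ ¬ IsUnit (α 1 1) := by
  unfold relPos
  split_ifs <;> constructor <;> intro h <;> first | exact absurd h (by decide) | tauto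

theorem relPos_eq_s2_iff {α : Matrix (Fin 2) (Fin 2) A} :
    relPos α = s2 ↔ ¬ IsUnit (α 1 0) ∧ ¬ IsUnit (α 0 0) ∧ IsUnit (α 1 1) := by
  unfold relPos
  split_ifs <;> constructor <;> intro h <;> first | exact absurd h (by decide) | tauto

theorem relPos_eq_s1_mul_s2_iff {α : Matrix (Fin 2) (Fin 2) A} :
    relPos α = s1 * s2 ↔ ¬ IsUnit (α 1 0) ∧ IsUnit (α 0 0) ∧ IsUnit (α 1 1) := by
  unfold relPos
  split_ifs <;> constructor <;> intro h <;> first | exact absurd h (by decide) | tauto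

theorem relPos_eq_s2_mul_s1_iff {α : Matrix (Fin 2) (Fin 2) A} :
    relPos α = s2 * s1 ↔ IsUnit (α 1 0) ∧ ¬ IsUnit α.det := by
  unfold relPos
  split_ifs <;> constructor <;> intro h <;> first | exact absurd h (by decide) | tauto

theorem relPos_eq_s1_mul_s2_mul_s1_iff {α : Matrix (Fin 2) (Fin 2) A} :
    relPos α = s1 * s2 * s1 ↔ IsUnit (α 1 0) ∧ IsUnit α.det := by
  unfold relPos
  split_ifs <;> constructor <;> intro h <;> first | exact absurd h (by decide) | tauto

theorem perm_three_eq (w : Equiv.Perm (Fin 3)) :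
    w = 1 ∨ w = s1 ∨ w = s2 ∨ w = s1 * s2 ∨ w = s2 * s1 ∨ w = s1 * s2 * s1 := by
  revert w
  decide

/-- Pivoting on the unit clears the top right entry. The scalars have total determinant 1, so the
complementary entry is exactly `α.det`. -/
theorem bEquiv_of_isUnit_zero_zero {α : Matrix (Fin 2) (Fin 2) A} (h : IsUnit (α 0 0)) :
    BEquiv α !![1, 0; α 1 0, α.det] := by
  obtain ⟨u, hu⟩ := h
  have e := u.inv_mul
  refine bEquiv_iff.2 ⟨1, u, u⁻¹, 1, 0, -(α 0 1 * u⁻¹.1), ?_⟩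
  simp only [Matrix.of_apply, Matrix.cons_val', Matrix.cons_val_zero, Matrix.cons_val_one,
    Matrix.cons_val_fin_one, Units.val_one, Matrix.det_fin_two, ← hu]
  refine ⟨?_, ?_, ?_, ?_⟩
  · linear_combination -e
  · linear_combination α 0 1 * e
  · linear_combination (-α 1 0) * e
  · linear_combination (α 1 0 * α 0 1) * e

theorem bEquiv_of_isUnit_one_one {α : Matrix (Fin 2) (Fin 2) A} (h : IsUnit (α 1 1)) :
    BEquiv α !![α.det, 0; α 1 0, 1] := by
  obtain ⟨u, hu⟩ := h
  have e := u.inv_mul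
  refine bEquiv_iff.2 ⟨1, u⁻¹, u, 1, -(α 0 1 * u⁻¹.1), 0, ?_⟩
  simp only [Matrix.of_apply, Matrix.cons_val', Matrix.cons_val_zero, Matrix.cons_val_one,
    Matrix.cons_val_fin_one, Units.val_one, Matrix.det_fin_two, ← hu]
  refine ⟨?_, ?_, ?_, ?_⟩
  · linear_combination (α 1 0 * α 0 1) * e
  · linear_combination α 0 1 * e
  · linear_combination (-α 1 0) * e
  · linear_combination -e

theorem bEquiv_of_isUnit_one_zero {α : Matrix (Fin 2) (Fin 2) A} (h : IsUnit (α 1 0)) :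
    BEquiv α !![0, α.det; 1, 0] := by
  obtain ⟨u, hu⟩ := h
  have e := u.inv_mul
  -- The sign offsets that of the antidiagonal in the determinant.
  refine bEquiv_iff.2 ⟨1, 1, u⁻¹, -u, -(α 0 0 * u⁻¹.1), α 1 1, ?_⟩
  simp only [Matrix.of_apply, Matrix.cons_val', Matrix.cons_val_zero, Matrix.cons_val_one,
    Matrix.cons_val_fin_one, Units.val_one, Units.val_neg, Matrix.det_fin_two, ← hu]
  refine ⟨?_, ?_, ?_, ?_⟩
  · linear_combination (α 0 0 * u⁻¹.1) * e
  · ring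
  · linear_combination -e
  · ring

variable [IsLocalRing A]

/-- Modulo the maximal ideal `α` is upper triangular, so the diagonal entries are only rescaled. -/
theorem BEquiv.isUnit_diag {α β : Matrix (Fin 2) (Fin 2) A} (h : BEquiv α β)
    (h0 : ¬ IsUnit (α 1 0)) (i : Fin 2) (hi : IsUnit (β i i)) : IsUnit (α i i) := by
  obtain ⟨b₁, b₂, c₁, c₂, t, s, h1, -, -, h4⟩ := bEquiv_iff.1 h
  by_contra hα
  have m0 : α 1 0 ∈ maximalIdeal A := h0
  have m1 : α i i ∈ maximalIdeal A := hα
  refine (?_ : β i i ∈ maximalIdeal A) hi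
  fin_cases i
  · exact h1 ▸ Ideal.mul_mem_right _ _
      (Ideal.add_mem _ (Ideal.mul_mem_left _ _ m1) (Ideal.mul_mem_left _ _ m0))
  · exact h4 ▸ Ideal.add_mem _ (Ideal.mul_mem_right _ _ (Ideal.mul_mem_left _ _ m0))
      (Ideal.mul_mem_right _ _ (Ideal.mul_mem_left _ _ m1))

theorem BEquiv.relPos_eq {α β : Matrix (Fin 2) (Fin 2) A} (h : BEquiv α β) :
    relPos α = relPos β := by
  obtain ⟨u, hu⟩ := h.apply_one_zero
  obtain ⟨w, hw⟩ := h.det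
  have e0 : IsUnit (β 1 0) ↔ IsUnit (α 1 0) := by rw [hu, Units.isUnit_units_mul]
  have e1 : IsUnit β.det ↔ IsUnit α.det := by rw [hw, Units.isUnit_units_mul]
  have e : ¬ IsUnit (α 1 0) → ∀ i, (IsUnit (β i i) ↔ IsUnit (α i i)) := fun h0 i =>
    ⟨h.isUnit_diag h0 i, h.symm.isUnit_diag (e0.not.2 h0) i⟩
  rcases perm_three_eq (relPos α) with h | h | h | h | h | h <;> rw [h, eq_comm]
  · rw [relPos_eq_one_iff] at h ⊢
    rwa [e0, e h.1, e h.1]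
  · rw [relPos_eq_s1_iff] at h ⊢
    rwa [e0, e h.1, e h.1]
  · rw [relPos_eq_s2_iff] at h ⊢
    rwa [e0, e h.1, e h.1]
  · rw [relPos_eq_s1_mul_s2_iff] at h ⊢
    rwa [e0, e h.1, e h.1]
  · rw [relPos_eq_s2_mul_s1_iff] at h ⊢
    rwa [e0, e1]
  · rw [relPos_eq_s1_mul_s2_mul_s1_iff] at h ⊢
    rwa [e0, e1]

theorem isUnit_det_iff {α : Matrix (Fin 2) (Fin 2) A} (h : ¬ IsUnit (α 1 0)) :
    IsUnit α.det ↔ IsUnit (α 0 0) ∧ IsUnit (α 1 1) := by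
  have m : α 0 1 * α 1 0 ∈ maximalIdeal A := Ideal.mul_mem_left _ _ h
  rw [← IsUnit.mul_iff, Matrix.det_fin_two]
  constructor
  · intro hu
    by_contra hn
    exact Ideal.sub_mem (maximalIdeal A) (show α 0 0 * α 1 1 ∈ maximalIdeal A from hn) m hu
  · intro hu
    by_contra hn
    have := Ideal.add_mem (maximalIdeal A)
      (show α 0 0 * α 1 1 - α 0 1 * α 1 0 ∈ maximalIdeal A from hn) m
    rw [sub_add_cancel] at this
    exact this hu

/-- That the top right entry is a unit comes for free from invertibility of `g`: otherwise the whole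
block would vanish modulo the maximal ideal, and with it the determinant. -/
theorem mem_M2_iff_relPos_lowerLeft {g : GL (Fin 3) A} :
    lowerLeft g ∈ M2 A ↔ relPos (lowerLeft g) = 1 := by
  rw [relPos_eq_one_iff]
  refine ⟨fun h => ⟨h.2.2.1, h.2.1, h.2.2.2⟩, fun h => ⟨?_, h.2.1, h.1, h.2.2⟩⟩
  by_contra h01
  have hd : IsUnit g.1.det := (Matrix.isUnit_iff_isUnit_det _).1 g.isUnit
  refine (?_ : g.1.det ∈ maximalIdeal A) hd
  have m0 : g.1 1 0 ∈ maximalIdeal A := h.2.1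
  have m1 : g.1 1 1 ∈ maximalIdeal A := h01
  have m2 : g.1 2 0 ∈ maximalIdeal A := h.1
  have m3 : g.1 2 1 ∈ maximalIdeal A := h.2.2
  rw [← Ideal.Quotient.eq_zero_iff_mem] at *
  rw [Matrix.det_fin_three]
  simp [m0, m1, m2, m3]

variable [IsNoetherianRing A]

/-- Both matrices have pivoted normal forms of the same shape, with a zero entry, so
`bEquiv_of_v_eq` applies. -/
theorem bEquiv_of_v_eq_of_isUnit {π : A} (hπ : Ideal.span {π} = maximalIdeal A)
    {α β : Matrix (Fin 2) (Fin 2) A} (h : v (α 1 0) = v (β 1 0)) (hd : v α.det = v β.det)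
    (hu : (IsUnit (α 0 0) ∧ IsUnit (β 0 0)) ∨ (IsUnit (α 1 1) ∧ IsUnit (β 1 1)) ∨
      (IsUnit (α 1 0) ∧ IsUnit (β 1 0))) : BEquiv α β := by
  obtain ⟨h1, h2⟩ | ⟨h1, h2⟩ | ⟨h1, h2⟩ := hu
  · refine (bEquiv_of_isUnit_zero_zero h1).trans
      ((bEquiv_of_v_eq hπ ?_ ⟨0, 1, rfl⟩).trans (bEquiv_of_isUnit_zero_zero h2).symm)
    simp [Fin.forall_fin_two, h, hd]
  · refine (bEquiv_of_isUnit_one_one h1).trans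
      ((bEquiv_of_v_eq hπ ?_ ⟨0, 1, rfl⟩).trans (bEquiv_of_isUnit_one_one h2).symm)
    simp [Fin.forall_fin_two, h, hd]
  · refine (bEquiv_of_isUnit_one_zero h1).trans
      ((bEquiv_of_v_eq hπ ?_ ⟨0, 0, rfl⟩).trans (bEquiv_of_isUnit_one_zero h2).symm)
    simp [Fin.forall_fin_two, hd]

/-- `p` is the parameter of the double cosets of the matrices with lower left part `α`. -/
def IsParam : GL3Param A → Matrix (Fin 2) (Fin 2) A → Prop
  | .fib_one o, α => ∃ h : α ∈ M2 A, orbitOf ⟨α, h⟩ = o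
  | .fib_s1 p, α => relPos α = s1 ∧ v (α 1 0) = p.1 ∧ v α.det = p.2
  | .fib_s2 p, α => relPos α = s2 ∧ v α.det = p.1 ∧ v (α 1 0) = p.2
  | .fib_s1s2 i, α => relPos α = s1 * s2 ∧ v (α 1 0) = i
  | .fib_s2s1 i, α => relPos α = s2 * s1 ∧ v α.det = i
  | .fib_s1s2s1, α => relPos α = s1 * s2 * s1

omit [IsNoetherianRing A] in
theorem IsParam.relPos_eq {p : GL3Param A} {α : Matrix (Fin 2) (Fin 2) A} (h : IsParam p α) :
    relPos α = p.perm := by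
  cases p with
  | fib_one o =>
    obtain ⟨h, -⟩ := h
    exact relPos_eq_one_iff.2 ⟨h.2.2.1, h.2.1, h.2.2.2⟩
  | fib_s1 p => exact h.1
  | fib_s2 p => exact h.1
  | fib_s1s2 i => exact h.1
  | fib_s2s1 i => exact h.1
  | fib_s1s2s1 => exact h

omit [IsNoetherianRing A] in
theorem IsParam.unique {p q : GL3Param A} {α : Matrix (Fin 2) (Fin 2) A} (hp : IsParam p α)
    (hq : IsParam q α) : p = q := by
  have h := hp.relPos_eq.symm.trans hq.relPos_eq
  cases p <;> cases q <;> first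
    | exact absurd h (by simp only [GL3Param.perm]; decide)
    | skip
  · obtain ⟨_, rfl⟩ := hp
    obtain ⟨_, rfl⟩ := hq
    rfl
  · rw [Prod.ext (Subtype.ext (hp.2.1.symm.trans hq.2.1))
      (Subtype.ext (hp.2.2.symm.trans hq.2.2))]
  · rw [Prod.ext (Subtype.ext (hp.2.1.symm.trans hq.2.1))
      (Subtype.ext (hp.2.2.symm.trans hq.2.2))]
  · rw [Subtype.ext (hp.2.symm.trans hq.2)]
  · rw [Subtype.ext (hp.2.symm.trans hq.2)]
  · rfl

/-- The hypothesis `hβ` supplies the unit in the top right corner, which `relPos` does not record;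
it holds for blocks of invertible matrices. -/
theorem IsParam.congr {π : A} (hπ : Ideal.span {π} = maximalIdeal A) {p : GL3Param A}
    {α β : Matrix (Fin 2) (Fin 2) A} (hp : IsParam p α) (h : BEquiv α β)
    (hβ : relPos β = 1 → β ∈ M2 A) :
    IsParam p β := by
  have h0 := h.v_one_zero hπ
  have h1 : v α.det = v β.det := (v_eq_iff hπ).2 h.det
  have h2 := h.relPos_eq
  cases p with
  | fib_one o =>
    have hβ := hβ (h2 ▸ hp.relPos_eq)
    obtain ⟨hα, rfl⟩ := hp
    exact ⟨hβ, orbitOf_eq_iff.2 h.symm⟩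
  | _ => simpa only [IsParam, h0, h1, h2] using hp

/-- Away from the identity fibre, each of `v (α 1 0)` and `v α.det` is either recorded by the
parameter or forced to be 0 by the relative position. -/
theorem IsParam.bEquiv {π : A} (hπ : Ideal.span {π} = maximalIdeal A) {p : GL3Param A}
    {α β : Matrix (Fin 2) (Fin 2) A} (hα : IsParam p α) (hβ : IsParam p β) : BEquiv α β := by
  have v0 : ∀ {x y : A}, IsUnit x → IsUnit y → v x = v y := fun hx hy =>
    ((v_eq_zero_iff hπ).2 hx).trans ((v_eq_zero_iff hπ).2 hy).symm
  cases p with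
  | fib_one o =>
    obtain ⟨hα, rfl⟩ := hα
    obtain ⟨hβ, h⟩ := hβ
    exact (orbitOf_eq_iff.1 h).symm
  | fib_s1 p =>
    exact bEquiv_of_v_eq_of_isUnit hπ (hα.2.1.trans hβ.2.1.symm) (hα.2.2.trans hβ.2.2.symm)
      (Or.inl ⟨(relPos_eq_s1_iff.1 hα.1).2.1, (relPos_eq_s1_iff.1 hβ.1).2.1⟩)
  | fib_s2 p =>
    exact bEquiv_of_v_eq_of_isUnit hπ (hα.2.2.trans hβ.2.2.symm) (hα.2.1.trans hβ.2.1.symm)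
      (Or.inr (Or.inl ⟨(relPos_eq_s2_iff.1 hα.1).2.2, (relPos_eq_s2_iff.1 hβ.1).2.2⟩))
  | fib_s1s2 i =>
    have h1 := relPos_eq_s1_mul_s2_iff.1 hα.1
    have h2 := relPos_eq_s1_mul_s2_iff.1 hβ.1
    exact bEquiv_of_v_eq_of_isUnit hπ (hα.2.trans hβ.2.symm)
      (v0 ((isUnit_det_iff h1.1).2 h1.2) ((isUnit_det_iff h2.1).2 h2.2))
      (Or.inl ⟨h1.2.1, h2.2.1⟩)
  | fib_s2s1 i =>
    have h1 := relPos_eq_s2_mul_s1_iff.1 hα.1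
    have h2 := relPos_eq_s2_mul_s1_iff.1 hβ.1
    exact bEquiv_of_v_eq_of_isUnit hπ (v0 h1.1 h2.1) (hα.2.trans hβ.2.symm)
      (Or.inr (Or.inr ⟨h1.1, h2.1⟩))
  | fib_s1s2s1 =>
    have h1 := relPos_eq_s1_mul_s2_mul_s1_iff.1 hα
    have h2 := relPos_eq_s1_mul_s2_mul_s1_iff.1 hβ
    exact bEquiv_of_v_eq_of_isUnit hπ (v0 h1.1 h2.1) (v0 h1.2 h2.2)
      (Or.inr (Or.inr ⟨h1.1, h2.1⟩))

omit [IsNoetherianRing A] in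
theorem exists_isParam_lowerLeft (g : GL (Fin 3) A) : ∃ p, IsParam p (lowerLeft g) := by
  have hv : ∀ {x : A}, ¬ IsUnit x → v x ∈ vp A := fun {x} hx => ⟨x, hx, rfl⟩
  rcases perm_three_eq (relPos (lowerLeft g)) with h | h | h | h | h | h
  · exact ⟨.fib_one _, mem_M2_iff_relPos_lowerLeft.2 h, rfl⟩
  · have h' := relPos_eq_s1_iff.1 h
    exact ⟨.fib_s1 (⟨_, hv h'.1⟩, ⟨_, hv fun hd => h'.2.2 ((isUnit_det_iff h'.1).1 hd).2⟩),
      h, rfl, rfl⟩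
  · have h' := relPos_eq_s2_iff.1 h
    exact ⟨.fib_s2 (⟨_, hv fun hd => h'.2.1 ((isUnit_det_iff h'.1).1 hd).1⟩, ⟨_, hv h'.1⟩),
      h, rfl, rfl⟩
  · exact ⟨.fib_s1s2 ⟨_, hv (relPos_eq_s1_mul_s2_iff.1 h).1⟩, h, rfl⟩
  · exact ⟨.fib_s2s1 ⟨_, hv (relPos_eq_s2_mul_s1_iff.1 h).2⟩, h, rfl⟩
  · exact ⟨.fib_s1s2s1, h⟩

omit [IsLocalRing A] [IsNoetherianRing A] in
theorem lowerLeft_eq {g : GL (Fin 3) A} {a b c d e f x y z : A}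
    (h : g.1 = !![x, y, z; a, b, e; c, d, f]) : lowerLeft g = !![a, b; c, d] := by
  ext i j
  simp only [lowerLeft, h]
  fin_cases i <;> fin_cases j <;> rfl

omit [IsNoetherianRing A] in
theorem isParam_s1 (x y : maximalIdeal A) :
    IsParam (.fib_s1 (toVp x, toVp y)) !![1, 0; x.1, y.1] := by
  refine ⟨relPos_eq_s1_iff.2 ⟨x.2, isUnit_one, y.2⟩, rfl, ?_⟩
  rw [Matrix.det_fin_two_of, one_mul, zero_mul, sub_zero]
  rfl

omit [IsNoetherianRing A] in
theorem isParam_s2 (x y : maximalIdeal A) :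
    IsParam (.fib_s2 (toVp x, toVp y)) !![x.1, 0; y.1, 1] := by
  refine ⟨relPos_eq_s2_iff.2 ⟨y.2, x.2, isUnit_one⟩, ?_, rfl⟩
  rw [Matrix.det_fin_two_of, mul_one, zero_mul, sub_zero]
  rfl

omit [IsNoetherianRing A] in
theorem isParam_s1s2 (x : maximalIdeal A) : IsParam (.fib_s1s2 (toVp x)) !![1, 0; x.1, 1] :=
  ⟨relPos_eq_s1_mul_s2_iff.2 ⟨x.2, isUnit_one, isUnit_one⟩, rfl⟩

theorem isParam_s2s1 {π : A} (hπ : Ideal.span {π} = maximalIdeal A) (x : maximalIdeal A) :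
    IsParam (.fib_s2s1 (toVp x)) !![0, x.1; 1, 0] := by
  have hd : (!![0, x.1; 1, 0] : Matrix (Fin 2) (Fin 2) A).det = (-1 : Aˣ) * x.1 := by
    rw [Matrix.det_fin_two_of, Units.val_neg, Units.val_one]
    ring
  refine ⟨relPos_eq_s2_mul_s1_iff.2 ⟨isUnit_one, ?_⟩, ?_⟩
  · rw [hd, Units.isUnit_units_mul]
    exact x.2
  · rw [hd, v_unit_mul hπ]
    rfl

omit [IsNoetherianRing A] in
theorem isParam_s1s2s1 : IsParam (.fib_s1s2s1 : GL3Param A) !![0, 1; 1, 0] :=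
  relPos_eq_s1_mul_s2_mul_s1_iff.2 ⟨isUnit_one, by simp [Matrix.det_fin_two_of]⟩

theorem exists_lowerLeft_isParam {π : A} (hπ : Ideal.span {π} = maximalIdeal A)
    (p : GL3Param A) : ∃ g : GL (Fin 3) A, IsParam p (lowerLeft g) := by
  have hv : ∀ i : vp A, ∃ x, toVp x = i := fun ⟨_, x, hx, h⟩ => ⟨⟨x, hx⟩, Subtype.ext h⟩
  have hg : ∀ M : Matrix (Fin 3) (Fin 3) A, IsUnit M.det → ∃ g : GL (Fin 3) A, g.1 = M :=
    fun M hM => ⟨Matrix.GeneralLinearGroup.mk'' M hM, rfl⟩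
  cases p with
  | fib_one o =>
    obtain ⟨α, rfl⟩ := Quotient.exists_rep o
    obtain ⟨g, hg⟩ := hg !![1, 0, 0; α.1 0 0, α.1 0 1, 0; α.1 1 0, α.1 1 1, 1]
      (by simpa [Matrix.det_fin_three] using α.2.1)
    have : lowerLeft g = α.1 := by
      rw [lowerLeft_eq hg]
      exact (Matrix.eta_fin_two α.1).symm
    refine ⟨g, ?_⟩
    rw [this]
    exact ⟨α.2, rfl⟩
  | fib_s1 p =>
    obtain ⟨i, j⟩ := p
    obtain ⟨x, rfl⟩ := hv i
    obtain ⟨y, rfl⟩ := hv j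
    obtain ⟨g, hg⟩ := hg !![0, 1, 0; 1, 0, 0; x.1, y.1, 1] (by simp [Matrix.det_fin_three])
    exact ⟨g, lowerLeft_eq hg ▸ isParam_s1 x y⟩
  | fib_s2 p =>
    obtain ⟨i, j⟩ := p
    obtain ⟨x, rfl⟩ := hv i
    obtain ⟨y, rfl⟩ := hv j
    obtain ⟨g, hg⟩ := hg !![1, 0, 0; x.1, 0, 1; y.1, 1, 0] (by simp [Matrix.det_fin_three])
    exact ⟨g, lowerLeft_eq hg ▸ isParam_s2 x y⟩
  | fib_s1s2 i =>
    obtain ⟨x, rfl⟩ := hv i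
    obtain ⟨g, hg⟩ := hg !![0, 0, 1; 1, 0, 0; x.1, 1, 0] (by simp [Matrix.det_fin_three])
    exact ⟨g, lowerLeft_eq hg ▸ isParam_s1s2 x⟩
  | fib_s2s1 i =>
    obtain ⟨x, rfl⟩ := hv i
    obtain ⟨g, hg⟩ := hg !![0, 1, 0; 0, x.1, 1; 1, 0, 0] (by simp [Matrix.det_fin_three])
    exact ⟨g, lowerLeft_eq hg ▸ isParam_s2s1 hπ x⟩
  | fib_s1s2s1 =>
    obtain ⟨g, hg⟩ := hg !![0, 0, 1; 0, 1, 0; 1, 0, 0] (by simp [Matrix.det_fin_three])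
    exact ⟨g, lowerLeft_eq hg ▸ isParam_s1s2s1⟩

/-- The double coset with a given parameter. -/
noncomputable def paramCoset {π : A} (hπ : Ideal.span {π} = maximalIdeal A) (p : GL3Param A) :
    BGB A := cosetOf (exists_lowerLeft_isParam hπ p).choose

/-- This frees the bijection from the chosen representatives: every explicit value becomes a check
on a 2×2 block. -/
theorem paramCoset_eq_iff {π : A} (hπ : Ideal.span {π} = maximalIdeal A) {p : GL3Param A}
    {g : GL (Fin 3) A} : paramCoset hπ p = cosetOf g ↔ IsParam p (lowerLeft g) := by
  have hp := (exists_lowerLeft_isParam hπ p).choose_spec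
  rw [paramCoset, cosetOf_eq_iff_bEquiv]
  exact ⟨fun h => hp.congr hπ h mem_M2_iff_relPos_lowerLeft.2, fun h => hp.bEquiv hπ h⟩

theorem paramCoset_bijective {π : A} (hπ : Ideal.span {π} = maximalIdeal A) :
    Function.Bijective (paramCoset hπ) := by
  constructor
  · intro p q h
    exact ((paramCoset_eq_iff hπ).1 h).unique (exists_lowerLeft_isParam hπ q).choose_spec
  · intro x
    obtain ⟨g, rfl⟩ := Quotient.exists_rep x
    obtain ⟨p, hp⟩ := exists_isParam_lowerLeft g
    exact ⟨p, (paramCoset_eq_iff hπ).2 hp⟩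

end RelativePosition

/-! ### The residue field and reduction modulo the maximal ideal -/

section Field

theorem relPos_lowerLeft_permGL {K : Type*} [CommRing K] [Nontrivial K]
    (w : Equiv.Perm (Fin 3)) : relPos (lowerLeft (permGL K w)) = w := by
  have h : lowerLeft (permGL K w) = !![if 1 = w 0 then 1 else 0, if 1 = w 1 then 1 else 0;
      if 2 = w 0 then 1 else 0, if 2 = w 1 then 1 else 0] := by
    ext i j
    fin_cases i <;> fin_cases j <;> rfl
  rw [h]
  rcases perm_three_eq w with rfl | rfl | rfl | rfl | rfl | rfl
  · exact relPos_eq_one_iff.2 (by simp)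
  · exact relPos_eq_s1_iff.2 (by simp [s1])
  · exact relPos_eq_s2_iff.2 (by simp [s2, Equiv.swap_apply_def])
  · exact relPos_eq_s1_mul_s2_iff.2 (by simp [s1, s2, Equiv.swap_apply_def])
  · exact relPos_eq_s2_mul_s1_iff.2 (by simp [s1, s2, Equiv.swap_apply_def])
  · exact relPos_eq_s1_mul_s2_mul_s1_iff.2 (by simp [s1, s2, Equiv.swap_apply_def])

/-- A field is the case with uniformizer 0, so the general classification applies to it. -/
theorem span_zero_eq_maximalIdeal (K : Type*) [Field K] :
    Ideal.span {(0 : K)} = maximalIdeal K := by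
  rw [IsLocalRing.maximalIdeal_eq_bot, Ideal.span_singleton_eq_bot.2 rfl]

theorem eq_zero_of_not_isUnit {K : Type*} [Field K] {x : K} (h : ¬ IsUnit x) : x = 0 :=
  not_ne_iff.1 (isUnit_iff_ne_zero.not.1 h)

/-- Over a field the only nonunit is 0, so `vp K` and `M2Orbits K` have at most one point each. -/
theorem GL3Param.perm_injective (K : Type*) [Field K] :
    Function.Injective (GL3Param.perm : GL3Param K → Equiv.Perm (Fin 3)) := by
  have hv : Subsingleton (vp K) := by
    refine ⟨?_⟩
    rintro ⟨_, x, hx, rfl⟩ ⟨_, y, hy, rfl⟩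
    exact Subtype.ext ((congrArg v (eq_zero_of_not_isUnit hx)).trans
      (congrArg v (eq_zero_of_not_isUnit hy)).symm)
  have ho : Subsingleton (M2Orbits K) := by
    refine ⟨fun o o' => ?_⟩
    obtain ⟨α, rfl⟩ := Quotient.exists_rep o
    obtain ⟨β, rfl⟩ := Quotient.exists_rep o'
    have hK := span_zero_eq_maximalIdeal K
    refine orbitOf_eq_iff.2 (bEquiv_of_v_eq hK ?_ ⟨0, 0, eq_zero_of_not_isUnit α.2.2.1⟩)
    simp [Fin.forall_fin_two, eq_zero_of_not_isUnit α.2.2.1, eq_zero_of_not_isUnit α.2.2.2.1,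
      eq_zero_of_not_isUnit α.2.2.2.2, eq_zero_of_not_isUnit β.2.2.1,
      eq_zero_of_not_isUnit β.2.2.2.1, eq_zero_of_not_isUnit β.2.2.2.2,
      (v_eq_zero_iff hK).2 α.2.1, (v_eq_zero_iff hK).2 β.2.1]
  intro p q h
  cases p <;> cases q <;> first
    | exact absurd h (by simp only [GL3Param.perm]; decide)
    | exact congrArg _ (Subsingleton.elim _ _)

theorem cosetOf_permGL_relPos {K : Type*} [Field K] (g : GL (Fin 3) K) :
    cosetOf (permGL K (relPos (lowerLeft g))) = cosetOf g := by
  obtain ⟨p, hp⟩ := exists_isParam_lowerLeft (permGL K (relPos (lowerLeft g)))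
  obtain ⟨q, hq⟩ := exists_isParam_lowerLeft g
  obtain rfl : p = q := GL3Param.perm_injective K (by
    rw [← hp.relPos_eq, ← hq.relPos_eq, relPos_lowerLeft_permGL])
  exact cosetOf_eq_iff_bEquiv.2 (hp.bEquiv (span_zero_eq_maximalIdeal K) hq)

theorem cosetOf_permGL_bijective (K : Type*) [Field K] :
    Function.Bijective fun w : Equiv.Perm (Fin 3) => cosetOf (permGL K w) := by
  constructor
  · intro w w' h
    have := (cosetOf_eq_iff_bEquiv.1 h).relPos_eq
    rwa [relPos_lowerLeft_permGL, relPos_lowerLeft_permGL] at this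
  · intro x
    obtain ⟨g, rfl⟩ := Quotient.exists_rep x
    exact ⟨_, cosetOf_permGL_relPos g⟩

/-- The relative position depends only on which elements are units, and the residue map detects
units. -/
theorem relPos_map_residue {A : Type*} [CommRing A] [IsLocalRing A]
    (α : Matrix (Fin 2) (Fin 2) A) : relPos (α.map (residue A)) = relPos α := by
  have e : ∀ i j, IsUnit (α.map (residue A) i j) ↔ IsUnit (α i j) := fun i j =>
    isUnit_map_iff (residue A) _
  have ed : IsUnit (α.map (residue A)).det ↔ IsUnit α.det := by
    rw [← isUnit_map_iff (residue A) α.det, RingHom.map_det]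
    rfl
  rcases perm_three_eq (relPos α) with h | h | h | h | h | h <;> rw [h]
  · rw [relPos_eq_one_iff] at h ⊢
    simpa only [e] using h
  · rw [relPos_eq_s1_iff] at h ⊢
    simpa only [e] using h
  · rw [relPos_eq_s2_iff] at h ⊢
    simpa only [e] using h
  · rw [relPos_eq_s1_mul_s2_iff] at h ⊢
    simpa only [e] using h
  · rw [relPos_eq_s2_mul_s1_iff] at h ⊢
    simpa only [e, ed] using h
  · rw [relPos_eq_s1_mul_s2_mul_s1_iff] at h ⊢
    simpa only [e, ed] using h

theorem reduce_cosetOf {A : Type*} [CommRing A] [IsLocalRing A] (g : GL (Fin 3) A) :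
    reduce A (cosetOf g) = cosetOf (permGL (ResidueField A) (relPos (lowerLeft g))) := by
  rw [← relPos_map_residue]
  exact (cosetOf_permGL_relPos (Matrix.GeneralLinearGroup.map (residue A) g)).symm

end Field
end LocalBruhat

/-! ### The parametrization theorem -/

open LocalBruhat in
theorem mainTheorem2 (A : Type*) [CommRing A] [IsLocalRing A] [IsPrincipalIdealRing A]
    (π : A) (hπ : Ideal.span {π} = IsLocalRing.maximalIdeal A) :
    -- `B \ GL_3(𝐤) / B` is identified with `S_3`
    (Function.Bijective fun w : Equiv.Perm (Fin 3) =>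
      cosetOf (permGL (IsLocalRing.ResidueField A) w)) ∧
    -- parametrisation of `B \ GL_3(A) / B`, fibre by fibre
    (∃ Φ : GL3Param A ≃ BGB A,
      (∀ p, reduce A (Φ p) = cosetOf (permGL (IsLocalRing.ResidueField A) p.perm)) ∧
      (∀ (g : GL (Fin 3) A) (h : g.1.submatrix ![1, 2] ![0, 1] ∈ M2 A),
        Φ (.fib_one (orbitOf ⟨g.1.submatrix ![1, 2] ![0, 1], h⟩)) = cosetOf g) ∧
      (∀ (x y : IsLocalRing.maximalIdeal A) (g : GL (Fin 3) A),
        g.1 = !![0, 1, 0; 1, 0, 0; x.1, y.1, 1] →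
          Φ (.fib_s1 (toVp x, toVp y)) = cosetOf g) ∧
      (∀ (x y : IsLocalRing.maximalIdeal A) (g : GL (Fin 3) A),
        g.1 = !![1, 0, 0; x.1, 0, 1; y.1, 1, 0] →
          Φ (.fib_s2 (toVp x, toVp y)) = cosetOf g) ∧
      (∀ (x : IsLocalRing.maximalIdeal A) (g : GL (Fin 3) A),
        g.1 = !![0, 0, 1; 1, 0, 0; x.1, 1, 0] → Φ (.fib_s1s2 (toVp x)) = cosetOf g) ∧
      (∀ (x : IsLocalRing.maximalIdeal A) (g : GL (Fin 3) A),
        g.1 = !![0, 1, 0; 0, x.1, 1; 1, 0, 0] → Φ (.fib_s2s1 (toVp x)) = cosetOf g) ∧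
      (∀ g : GL (Fin 3) A,
        g.1 = !![0, 0, 1; 0, 1, 0; 1, 0, 0] → Φ .fib_s1s2s1 = cosetOf g)) ∧
    -- parametrisation of the orbits on the `2 × 2` matrices
    (∃ Ψ : M2Param A ≃ M2Orbits A,
      (∀ (i j l : ℕ) (hi : 1 ≤ i) (hij : i < j) (hl : 1 ≤ l) (hlj : l < j)
        (hj : (j : ℕ∞) < len A) (hne : i + l ≠ j) (a : Aˣ) (α : M2 A),
        α.1 = !![π ^ i, 1; π ^ j * a.1, π ^ l] →
          Ψ (.generic i j l hi hij hl hlj hj hne (unitMod _ a)) = orbitOf α) ∧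
      (∀ (i j l : ℕ) (hi : 1 ≤ i) (hij : i < j) (hl : 1 ≤ l) (hlj : l < j)
        (hj : (j : ℕ∞) < len A) (heq : i + l = j) (δ : ℕ∞) (hδ : δ ≤ len A - j) (a : Aˣ)
        (ha : unitMod (min ((eps i j l : ℕ∞) + δ) (len A - j)) a ∈ unitsDelta A _ δ) (α : M2 A),
        α.1 = !![π ^ i, 1; π ^ j * a.1, π ^ l] →
          Ψ (.special i j l hi hij hl hlj hj heq δ hδ ⟨unitMod _ a, ha⟩) = orbitOf α) ∧
      (∀ (α : M2 A) (h : α.1.map v ∈ discreteSet (len A)),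
        Ψ (.discrete ⟨α.1.map v, h⟩) = orbitOf α)) := by
  refine ⟨cosetOf_permGL_bijective _,
    ⟨Equiv.ofBijective _ (paramCoset_bijective hπ), fun p => ?_, fun g h => ?_,
      fun x y g hg => ?_, fun x y g hg => ?_, fun x g hg => ?_, fun x g hg => ?_, fun g hg => ?_⟩,
    ⟨Equiv.ofBijective _ ⟨m2Orbit_injective hπ, m2Orbit_surjective hπ⟩,
      fun i j l hi hij hl hlj hj hne a α hα => m2Orbit_generic hπ hi hij hl hlj hj hne a α hα,
      fun i j l hi hij hl hlj hj heq δ hδ a ha α hα =>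
        m2Orbit_special hπ hi hij hl hlj hj heq hδ a ha α hα,
      fun α h => m2Orbit_discrete hπ α h⟩⟩
  · exact (reduce_cosetOf _).trans
      (by rw [(exists_lowerLeft_isParam hπ p).choose_spec.relPos_eq])
  · exact (paramCoset_eq_iff hπ).2 ⟨h, rfl⟩
  · exact (paramCoset_eq_iff hπ).2 (lowerLeft_eq hg ▸ isParam_s1 x y)
  · exact (paramCoset_eq_iff hπ).2 (lowerLeft_eq hg ▸ isParam_s2 x y)
  · exact (paramCoset_eq_iff hπ).2 (lowerLeft_eq hg ▸ isParam_s1s2 x)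
  · exact (paramCoset_eq_iff hπ).2 (lowerLeft_eq hg ▸ isParam_s2s1 hπ x)
  · exact (paramCoset_eq_iff hπ).2 (lowerLeft_eq hg ▸ isParam_s1s2s1)
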